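/- **Conventions.** All matroids are finite. For a matroid $M$ on $E$ and a flat $F$, let $M^F$ be the restriction of $M$ to $F$ and $M_F$ the contraction of $M$ by $F$; $\chi_M(t)=\sum_F \mu(\hat 0,F)\,t^{\mathrm{rk}(M)-\mathrm{rk}(F)}$ is the characteristic polynomial of the lattice of flats of $M$. The inverse Kazhdan–Lusztig polynomials $Q_M(t)\in\mathbb{Z}[t]$ are the unique assignment of a polynomial to each matroid such that: if $\mathrm{rk}(M)=0$, then $Q_M=1$ when $E=\varnothing$ and $Q_M=0$ otherwise; if $\mathrm{rk}(M)>0$, then $\deg Q_M<\mathrm{rk}(M)/2$; and for every $M$ $$(-t)^{\mathrm{rk}(M)}Q_M(t^{-1})=\sum_{F\text{ flat of }M}(-1)^{\mathrm{rk}(F)}\,Q_{M^F}(t)\;t^{\mathrm{rk}(M)-\mathrm{rk}(F)}\chi_{M_F}(t^{-1}).$$ A hyperplane $H$ of a matroid $M$ of rank $k$ is *stressed* if every subset of $H$ of cardinality $k$ is a circuit. Its *relaxation* $\widetilde M$ is the matroid whose bases are the bases of $M$ together with all subsets of $H$ of cardinality $k$. For $a\ge 1$ and $i,b\ge 0$ consider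 the top-aligned diagram that consists, from left to right, of one column of height $a$, then $i$ columns of height $2$, then $b$ columns of height $1$. Let $\mathrm{syt}(a,i,b)$ be the number of standard Young tableaux of this shape, that is, of fillings by $1,\dots,a+2i+b$, each used once, that strictly increase along rows and down columns (this number is $0$ if $a=1$ and $i>0$, as the diagram is then not a Young diagram). Let $\overline{\mathrm{syt}}(a,i,b)$ be the number of those tableaux whose maximal entry is at the bottom of the first or of the $(i+1)$-th column. **Theorem.** (1) For all integers $0\le k\le n$ with $n\ge 1$, the uniform matroid $U_{k,n}$ of rank $k$ on $n$ elements satisfies $$Q_{U_{k,n}}(t)=\sum_{i=0}^{\lfloor (k-1)/2\rfloor}\mathrm{syt}(n-k+1,\,i,\,k-2i-1)\,t^i$$ (the sum is empty for $k=0$). (2) Let $k,h\ge 1$ be integers with $h\ge k-1$. There is exactly one polynomial $q_{k,h}(t)\in\mathbb{Z}[t]$ such that $Q_{\widetilde M}(t)=Q_M(t)+q_{k,h}(t)$ for every matroid $M$ of rank $k$ and every stressed hyperplane $H$ of $M$ of cardinality $h$, where $\widetilde M$ is the relaxation of $H$ in $M$. It is given by $$q_{k,h}(t)=\sum_{i=0}^{\lfloor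 (k-1)/2\rfloor}\overline{\mathrm{syt}}(h-k+2,\,i,\,k-2i-1)\,t^i ,$$ and its coefficients are non-negative. If $h\ge k$, then its degree is $\lfloor (k-1)/2\rfloor$. -/

import Mathlib

/-! Modulo the term of the ground set, the recursion equates `t ^ r * Q(t⁻¹) - Q(t)` up to sign
with the sum over the proper flats. As `2 * deg Q < r`, the two polynomials on the left have
disjoint supports, so the proper flats determine `Q`; a solution exists since their sum is
antisymmetric under `p ↦ t ^ r * p(t⁻¹)`.

Whitney's theorem turns the characteristic polynomial of an interval `[F, E]` of flats into a signed
sum over all sets between `F` and `E`. This sum vanishes for every other set `F`, so that flats may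
be replaced by sets. For a uniform matroid, exchanging the sums over `F` and over the sets
containing it leaves a truncated binomial expansion of `(1 - (1 + t)) ^ n`, minus its reflection.

Relaxing a stressed hyperplane `H` changes ranks only on subsets of `H`, where both matroids are
uniform, so the change of the sum over the proper flats is `1 - t` times a truncated binomial
expansion, apart from a term that is too high in degree to matter.

Removing the maximal entry of a tableau gives a recursion in the shape, which is Pascal's rule for
the same truncated expansions. -/

open Polynomial

universe u

noncomputable section

namespace MatroidKL

section Matroids

variable {α : Type u} [Finite α]

/-- The rank of a set in a matroid on a finite type, as a natural number. -/
def rk (M : Matroid α) (X : Set α) : ℕ := (M.eRk X).toNat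

/-- The rank of a matroid. -/
def rank (M : Matroid α) : ℕ := rk M M.E

/-- The lattice of flats, ordered by inclusion. -/
abbrev Flats (M : Matroid α) : Type u := {F : Set α // M.IsFlat F}

/-- The smallest flat, consisting of the loops. -/
def botFlat (M : Matroid α) : Flats M := ⟨M.closure ∅, M.isFlat_closure ∅⟩

open Classical in
/-- The Möbius function of the lattice of flats. -/
def moebius (M : Matroid α) (F G : Flats M) : ℤ :=
  letI : Fintype (Flats M) := Fintype.ofFinite _
  letI : LocallyFiniteOrder (Flats M) := Fintype.toLocallyFiniteOrder
  IncidenceAlgebra.mu ℤ F G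

/-- The characteristic polynomial of the lattice of flats,
`χ_M(t) = ∑_F μ(0̂, F) t ^ (rk M - rk F)`. -/
def charPoly (M : Matroid α) : ℤ[X] :=
  ∑ᶠ F : Flats M, C (moebius M (botFlat M) F) * X ^ (rank M - rk M F.1)

/-- The three conditions which determine the inverse Kazhdan–Lusztig polynomials. The localization
of `M` at a flat `F` is `M.restrict F`, the contraction of `M` by `F` is `M.contract F`, and
`reflect d p` is `t ^ d * p(t⁻¹)` for a polynomial `p` of degree at most `d`. -/
structure IsInverseKL (Q : Matroid α → ℤ[X]) : Prop where
  rank_zero_of_empty : ∀ M : Matroid α, rank M = 0 → M.E = ∅ → Q M = 1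
  rank_zero_of_nonempty : ∀ M : Matroid α, rank M = 0 → M.E.Nonempty → Q M = 0
  degree_lt : ∀ M : Matroid α, 0 < rank M → 2 * (Q M).natDegree < rank M
  recursion : ∀ M : Matroid α,
    (-1) ^ rank M * reflect (rank M) (Q M) =
      ∑ᶠ F : Flats M, (-1) ^ rk M F.1 * Q (M.restrict F.1) *
        reflect (rank M - rk M F.1) (charPoly (M.contract F.1))

/-- The inverse Kazhdan–Lusztig polynomial `Q_M`: the value at `M` of the (unique) assignment
of polynomials to matroids that satisfies the three conditions of `IsInverseKL`. -/
def inverseKL (M : Matroid α) : ℤ[X] :=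
  Classical.epsilon (fun Q : Matroid α → ℤ[X] => IsInverseKL Q) M

/-- A stressed hyperplane: a flat of corank one all of whose subsets of cardinality `rank M`
are circuits. -/
structure IsStressedHyperplane (M : Matroid α) (H : Set α) : Prop where
  isFlat : M.IsFlat H
  rk_add_one : rk M H + 1 = rank M
  isCircuit : ∀ S ⊆ H, S.ncard = rank M → M.IsCircuit S

theorem ncard_of_isBase {M : Matroid α} {B : Set α} (hB : M.IsBase B) : B.ncard = rank M := by
  rw [rank, rk, M.eRk_ground, ← hB.eRk_eq_eRank, hB.indep.eRk_eq_encard, Set.ncard_def]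

theorem isBase_of_indep_of_ncard {M : Matroid α} {I : Set α} (hI : M.Indep I)
    (h : I.ncard = rank M) : M.IsBase I := by
  obtain ⟨B, hB, hIB⟩ := hI.exists_isBase_superset
  have : I = B := Set.eq_of_subset_of_ncard_le hIB (by rw [ncard_of_isBase hB, h]) (Set.toFinite _)
  exact this ▸ hB

theorem exists_mem_diff_of_ncard_eq {X Y : Set α} (h : X.ncard = Y.ncard) {a : α}
    (ha : a ∈ X \ Y) : ∃ b, b ∈ Y \ X := by
  by_contra hcon
  push Not at hcon
  have hYX : Y ⊆ X := fun b hb => by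
    by_contra hbX
    exact hcon b ⟨hb, hbX⟩
  have : Y = X := Set.eq_of_subset_of_ncard_le hYX h.le (Set.toFinite _)
  exact ha.2 (this ▸ ha.1)

theorem ncard_exchange {X : Set α} {a b : α} (ha : a ∈ X) (hb : b ∉ X) :
    (insert b (X \ {a})).ncard = X.ncard := by
  rw [Set.ncard_insert_of_notMem (fun h => hb h.1) (Set.toFinite _)]
  exact Set.ncard_sdiff_singleton_add_one ha (Set.toFinite _)

theorem relax_exchange {M : Matroid α} {H : Set α} (hH : IsStressedHyperplane M H) :
    Matroid.ExchangeProperty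
      (fun B => M.IsBase B ∨ (B ⊆ H ∧ B.ncard = rank M)) := by
  have card_eq : ∀ B : Set α, (M.IsBase B ∨ (B ⊆ H ∧ B.ncard = rank M)) → B.ncard = rank M := by
    rintro B (hB | hB)
    · exact ncard_of_isBase hB
    · exact hB.2
  intro X Y hX hY a ha
  have hXk := card_eq X hX
  have hYk := card_eq Y hY
  -- if the remaining part of `X` and all of `Y` lie in `H`, any exchange works
  have easy : X \ {a} ⊆ H → Y ⊆ H → ∃ b ∈ Y \ X, M.IsBase (insert b (X \ {a})) ∨
      (insert b (X \ {a}) ⊆ H ∧ (insert b (X \ {a})).ncard = rank M) := by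
    intro h1 h2
    obtain ⟨b, hb⟩ := exists_mem_diff_of_ncard_eq (hXk.trans hYk.symm) ha
    exact ⟨b, hb, Or.inr ⟨Set.insert_subset (h2 hb.1) h1, by rw [ncard_exchange ha.1 hb.2, hXk]⟩⟩
  -- an element of `Y` outside the closure of `X \ {a}` can be used for the exchange
  have key : M.Indep (X \ {a}) → (∃ b ∈ Y, b ∈ M.E ∧ b ∉ M.closure (X \ {a})) →
      ∃ b ∈ Y \ X, M.IsBase (insert b (X \ {a})) ∨
        (insert b (X \ {a}) ⊆ H ∧ (insert b (X \ {a})).ncard = rank M) := by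
    rintro hI ⟨b, hbY, hbE, hb⟩
    have hb' : b ∉ X \ {a} := fun h => hb (M.subset_closure _ hI.subset_ground h)
    have hbX : b ∉ X := fun h => hb' ⟨h, fun hba => ha.2 (by
      rw [Set.mem_singleton_iff] at hba; exact hba ▸ hbY)⟩
    refine ⟨b, ⟨hbY, hbX⟩, Or.inl (isBase_of_indep_of_ncard ?_ ?_)⟩
    · exact (hI.insert_indep_iff.2 (Or.inl ⟨hbE, hb⟩))
    · rw [ncard_exchange ha.1 hbX, hXk]
  rcases hX with hX | ⟨hXH, -⟩
  · rcases hY with hY | ⟨hYH, -⟩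
    · obtain ⟨b, hb, hb'⟩ := hX.exchange hY ha
      exact ⟨b, hb, Or.inl hb'⟩
    · by_cases hsub : X \ {a} ⊆ H
      · exact easy hsub hYH
      · have hI : M.Indep (X \ {a}) := hX.indep.subset Set.sdiff_subset
        apply key hI
        by_contra hcon
        push Not at hcon
        have hYE : Y ⊆ M.E := hYH.trans hH.isFlat.subset_ground
        have hYcl : Y ⊆ M.closure (X \ {a}) := fun b hb => hcon b hb (hYE hb)
        obtain ⟨e, heX, heH⟩ := Set.not_subset.1 hsub
        have hC := hH.isCircuit Y hYH hYk
        obtain ⟨y, hy⟩ := hC.nonempty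
        have hJ : M.Indep (Y \ {y}) := hC.sdiff_singleton_indep hy
        have heE : e ∈ M.E := hI.subset_ground heX
        have hecl : e ∉ M.closure (Y \ {y}) := fun h => heH (by
          have := M.closure_subset_closure (Set.sdiff_subset.trans hYH : Y \ {y} ⊆ H) h
          rwa [hH.isFlat.closure] at this)
        have hJe : M.Indep (insert e (Y \ {y})) := hJ.insert_indep_iff.2 (Or.inl ⟨heE, hecl⟩)
        have hsub2 : insert e (Y \ {y}) ⊆ M.closure (X \ {a}) :=
          Set.insert_subset (M.subset_closure _ hI.subset_ground heX)
            (Set.sdiff_subset.trans hYcl)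
        have hle := hJe.encard_le_eRk_of_subset hsub2
        rw [M.eRk_closure_eq, hI.eRk_eq_encard, ← (Set.toFinite _).cast_ncard_eq,
          ← (Set.toFinite _).cast_ncard_eq, Nat.cast_le,
          ncard_exchange hy (fun h => heH (hYH h)), hYk] at hle
        have := Set.ncard_sdiff_singleton_add_one ha.1 (Set.toFinite X)
        omega
  · rcases hY with hY | ⟨hYH, -⟩
    · have hC := hH.isCircuit X hXH hXk
      have hI : M.Indep (X \ {a}) := hC.sdiff_singleton_indep ha.1
      apply key hI
      by_contra hcon
      push Not at hcon
      have hYcl : Y ⊆ M.closure (X \ {a}) := fun b hb => hcon b hb (hY.subset_ground hb)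
      have hle := hY.indep.encard_le_eRk_of_subset hYcl
      rw [M.eRk_closure_eq, hI.eRk_eq_encard, ← (Set.toFinite _).cast_ncard_eq,
          ← (Set.toFinite _).cast_ncard_eq, Nat.cast_le, hYk] at hle
      have := Set.ncard_sdiff_singleton_add_one ha.1 (Set.toFinite X)
      omega
    · exact easy (Set.sdiff_subset.trans hXH) hYH

/-- The relaxation of a stressed hyperplane `H`: the bases are those of `M` together with
all subsets of `H` of cardinality `rank M`. -/
def relax (M : Matroid α) (H : Set α) (hH : IsStressedHyperplane M H) : Matroid α :=
  Matroid.ofIsBaseOfFinite (E := M.E) (Set.toFinite _)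
    (fun B => M.IsBase B ∨ (B ⊆ H ∧ B.ncard = rank M))
    (M.exists_isBase.imp fun _ h => Or.inl h)
    (relax_exchange hH)
    (by
      rintro B (hB | hB)
      · exact hB.subset_ground
      · exact hB.1.trans hH.isFlat.subset_ground)

end Matroids

/-- The uniform matroid `U_{k,n}` on `n` elements, whose bases are the sets of cardinality `k`. -/
def uniform (k n : ℕ) (hkn : k ≤ n) : Matroid (Fin n) :=
  Matroid.ofIsBaseOfFinite (E := Set.univ) (Set.toFinite _) (fun B => B.ncard = k)
    (by
      obtain ⟨s, -, hs⟩ := Finset.exists_subset_card_eq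
        (s := (Finset.univ : Finset (Fin n))) (n := k) (by simpa using hkn)
      exact ⟨(s : Set (Fin n)), by rw [Set.ncard_coe_finset, hs]⟩)
    (fun X Y hX hY a ha => by
      obtain ⟨b, hb⟩ := exists_mem_diff_of_ncard_eq (hX.trans hY.symm) ha
      exact ⟨b, hb, (ncard_exchange ha.1 hb.2).trans hX⟩)
    (fun _ _ => Set.subset_univ _)

/-- The property that characterizes `q_{k,h}`: for every matroid `M` of rank `k`, relaxing a
stressed hyperplane of cardinality `h` changes the inverse Kazhdan–Lusztig polynomial by `q`. -/
def IsRelaxationPolynomial (k h : ℕ) (q : ℤ[X]) : Prop :=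
  ∀ (α : Type u) [Finite α] (M : Matroid α) (H : Set α) (hH : IsStressedHyperplane M H),
    rank M = k → H.ncard = h → inverseKL (relax M H hH) = inverseKL M + q

section Tableaux

/-- The boxes (row, column), numbered from `0`, of the diagram which consists of a column of
height `a`, then `i` columns of height `2`, then `b` columns of height `1`, all aligned
at the top. -/
def sytCells (a i b : ℕ) : Finset (ℕ × ℕ) :=
  (Finset.range a ×ˢ {0}) ∪ (Finset.range 2 ×ˢ Finset.Ico 1 (1 + i)) ∪
    ({0} ×ˢ Finset.Ico (1 + i) (1 + i + b))

/-- The standard Young tableaux of this shape, as functions which are `0` outside the shape.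
There are none if the boxes do not form a Young diagram (as for `a = 1` and `i > 0`). -/
def Syt (a i b : ℕ) : Set (ℕ × ℕ → ℕ) :=
  {T | IsLowerSet (sytCells a i b : Set (ℕ × ℕ)) ∧
    (∀ c, c ∉ sytCells a i b → T c = 0) ∧
    Set.BijOn T (sytCells a i b) (Set.Icc 1 (a + 2 * i + b)) ∧
    (∀ r c c', c < c' → (r, c) ∈ sytCells a i b → (r, c') ∈ sytCells a i b →
      T (r, c) < T (r, c')) ∧
    (∀ r r' c, r < r' → (r, c) ∈ sytCells a i b → (r', c) ∈ sytCells a i b →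
      T (r, c) < T (r', c))}

/-- The tableaux whose maximal entry is at the bottom of the first or of the `(i+1)`-th column
(the columns with index `0` and `i`). -/
def SytBar (a i b : ℕ) : Set (ℕ × ℕ → ℕ) :=
  {T | T ∈ Syt a i b ∧ ∃ r c, (c = 0 ∨ c = i) ∧ (r, c) ∈ sytCells a i b ∧
    (r + 1, c) ∉ sytCells a i b ∧ T (r, c) = a + 2 * i + b}

def syt (a i b : ℕ) : ℕ := (Syt a i b).ncard

def sytBar (a i b : ℕ) : ℕ := (SytBar a i b).ncard

end Tableaux

end MatroidKL

end

noncomputable section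

namespace MatroidKL

section StandardLabelings

variable {P : Type*} [PartialOrder P]

/-- Standard labelings of a finite lower set `D` of a poset, i.e. its linear extensions; for
`P = ℕ × ℕ` these are the standard Young tableaux of shape `D`. As in `Syt`, a labeling is `0`
outside `D`, and there is none if `D` is not a lower set. -/
structure IsStandardLabeling (D : Finset P) (T : P → ℕ) : Prop where
  isLowerSet : IsLowerSet (D : Set P)
  eq_zero : ∀ c ∉ D, T c = 0
  bijOn : Set.BijOn T D (Set.Icc 1 D.card)
  strictMonoOn : StrictMonoOn T D

namespace IsStandardLabeling

variable {D : Finset P} {T : P → ℕ} {c d : P}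

theorem le_card (hT : IsStandardLabeling D T) (hd : d ∈ D) : T d ≤ D.card :=
  (hT.bijOn.mapsTo hd).2

theorem eq_of_apply_eq_card (hT : IsStandardLabeling D T) (hc : T c = D.card) (hd : d ∈ D)
    (hcd : c ≤ d) : c = d := by
  by_contra hne
  have hlt := hT.strictMonoOn (hT.isLowerSet hcd hd) hd (lt_of_le_of_ne hcd hne)
  exact (hlt.trans_le (hT.le_card hd)).ne hc

theorem exists_apply_eq_card (hT : IsStandardLabeling D T) (hD : D.Nonempty) :
    ∃ c ∈ D, T c = D.card :=
  hT.bijOn.surjOn ⟨hD.card_pos, le_rfl⟩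

theorem finite_setOf (D : Finset P) : {T | IsStandardLabeling D T}.Finite := by
  refine Set.Finite.of_injOn (f := fun (T : P → ℕ) (d : D) => T d)
    (t := {f | ∀ d, f d ∈ Set.Iic D.card}) (fun T hT d => IsStandardLabeling.le_card hT d.2) ?_
    (Set.Finite.pi' fun _ => Set.finite_Iic _)
  intro T hT T' hT' h
  funext c
  by_cases hc : c ∈ D
  · exact congrFun h ⟨c, hc⟩
  · rw [hT.eq_zero c hc, hT'.eq_zero c hc]

variable [DecidableEq P]

theorem update_zero (hT : IsStandardLabeling D T) (hcD : c ∈ D) (hc : T c = D.card) :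
    IsStandardLabeling (D.erase c) (Function.update T c 0) := by
  have hagree : Set.EqOn T (Function.update T c 0) (D.erase c : Finset P) := fun d hd =>
    (Function.update_of_ne (Finset.ne_of_mem_erase hd) _ _).symm
  refine ⟨?_, ?_, ?_, ?_⟩
  · intro e d hde he
    rw [Finset.mem_coe, Finset.mem_erase] at he ⊢
    refine ⟨?_, hT.isLowerSet hde he.2⟩
    rintro rfl
    exact he.1 (hT.eq_of_apply_eq_card hc he.2 hde).symm
  · intro d hd
    by_cases hdc : d = c
    · rw [hdc, Function.update_self]
    · rw [Function.update_of_ne hdc]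
      exact hT.eq_zero d fun h => hd (Finset.mem_erase.2 ⟨hdc, h⟩)
  · have hbij := hT.bijOn.sdiff_singleton (a := c) hcD
    rw [hc, ← Finset.coe_erase] at hbij
    have hIcc : Set.Icc 1 D.card \ {D.card} = Set.Icc 1 (D.erase c).card := by
      ext x
      rw [Finset.card_erase_of_mem hcD, Set.mem_sdiff, Set.mem_Icc, Set.mem_Icc,
        Set.mem_singleton_iff]
      omega
    exact (hIcc ▸ hbij).congr hagree
  · exact (hT.strictMonoOn.mono (Finset.coe_subset.2 (D.erase_subset c))).congr hagree

theorem update_card (hT : IsStandardLabeling (D.erase c) T) (hD : IsLowerSet (D : Set P))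
    (hcD : c ∈ D) : IsStandardLabeling D (Function.update T c D.card) := by
  have hcard := Finset.card_erase_add_one hcD
  have hagree : Set.EqOn T (Function.update T c D.card) (D.erase c : Finset P) := fun d hd =>
    (Function.update_of_ne (Finset.ne_of_mem_erase hd) _ _).symm
  refine ⟨hD, ?_, ?_, ?_⟩
  · intro d hd
    rw [Function.update_of_ne (ne_of_mem_of_not_mem hcD hd).symm]
    exact hT.eq_zero d fun h => hd (Finset.mem_of_mem_erase h)
  · have hbij := (hT.bijOn.congr hagree).insert (a := c) (by
      rw [Function.update_self, Set.mem_Icc]; omega)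
    rw [Function.update_self, ← Finset.coe_insert, Finset.insert_erase hcD] at hbij
    convert hbij using 1
    ext x
    rw [Set.mem_insert_iff, Set.mem_Icc, Set.mem_Icc]
    omega
  · intro d hd e he hde
    have hdc : d ≠ c := by
      rintro rfl
      exact (D.notMem_erase d) (hT.isLowerSet hde.le (Finset.mem_erase.2 ⟨hde.ne', he⟩))
    have hd' : d ∈ D.erase c := Finset.mem_erase.2 ⟨hdc, hd⟩
    rw [Function.update_of_ne hdc]
    by_cases hec : e = c
    · rw [hec, Function.update_self]
      have := hT.le_card hd'
      omega
    · rw [Function.update_of_ne hec]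
      exact hT.strictMonoOn hd' (Finset.mem_erase.2 ⟨hec, he⟩) hde

theorem ncard_setOf_apply_eq_card (hD : IsLowerSet (D : Set P)) (hcD : c ∈ D) :
    {T | IsStandardLabeling D T ∧ T c = D.card}.ncard =
      {T | IsStandardLabeling (D.erase c) T}.ncard := by
  refine Set.ncard_congr (fun T _ => Function.update T c 0) (fun T hT => hT.1.update_zero hcD hT.2)
    ?_ fun T hT => ⟨Function.update T c D.card, ⟨hT.update_card hD hcD, by simp⟩, ?_⟩
  · rintro T T' ⟨-, hT⟩ ⟨-, hT'⟩ h
    rw [← Function.update_eq_self c T, ← Function.update_eq_self c T', hT, hT',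
      ← Function.update_idem 0, h, Function.update_idem]
  · rw [Function.update_idem, ← hT.eq_zero c (D.notMem_erase c), Function.update_eq_self]

theorem ncard_setOf_exists_mem (hD : IsLowerSet (D : Set P)) {S : Finset P} (hS : S ⊆ D) :
    {T | IsStandardLabeling D T ∧ ∃ c ∈ S, T c = D.card}.ncard =
      ∑ c ∈ S, {T | IsStandardLabeling (D.erase c) T}.ncard := by
  have hunion : {T | IsStandardLabeling D T ∧ ∃ c ∈ S, T c = D.card} =
      ⋃ c ∈ S, {T | IsStandardLabeling D T ∧ T c = D.card} := by
    ext T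
    simp only [Set.mem_ofPred_eq, Set.mem_iUnion, exists_prop]
    tauto
  have hdisj : (S : Set P).PairwiseDisjoint
      fun c => {T | IsStandardLabeling D T ∧ T c = D.card} := by
    intro c hc d hd hcd
    rw [Function.onFun, Set.disjoint_left]
    rintro T ⟨hT, hTc⟩ ⟨-, hTd⟩
    exact hcd (hT.bijOn.injOn (hS hc) (hS hd) (hTc.trans hTd.symm))
  rw [hunion, ← finsum_mem_coe_finset]
  simp only [← Finset.mem_coe]
  rw [S.finite_toSet.ncard_biUnion
    (fun c _ => (finite_setOf D).subset fun T hT => hT.1) hdisj]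
  exact finsum_mem_congr rfl fun c hc => ncard_setOf_apply_eq_card hD (hS hc)

theorem ncard_setOf (hD : IsLowerSet (D : Set P)) (hne : D.Nonempty) {S : Finset P} (hS : S ⊆ D)
    (hmax : ∀ c ∈ D, c ∉ S → ∃ d ∈ D, c < d) :
    {T | IsStandardLabeling D T}.ncard =
      ∑ c ∈ S, {T | IsStandardLabeling (D.erase c) T}.ncard := by
  rw [← ncard_setOf_exists_mem hD hS]
  congr 1
  ext T
  refine ⟨fun hT => ⟨hT, ?_⟩, fun hT => hT.1⟩
  obtain ⟨c, hcD, hc⟩ := hT.exists_apply_eq_card hne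
  refine ⟨c, ?_, hc⟩
  by_contra hcS
  obtain ⟨d, hd, hcd⟩ := hmax c hcD hcS
  exact hcd.ne (hT.eq_of_apply_eq_card hc hd hcd.le)

end IsStandardLabeling

end StandardLabelings

section Tableaux

theorem mem_sytCells {a i b r c : ℕ} : (r, c) ∈ sytCells a i b ↔
    (c = 0 ∧ r < a) ∨ (1 ≤ c ∧ c < 1 + i ∧ r < 2) ∨ (1 + i ≤ c ∧ c < 1 + i + b ∧ r = 0) := by
  simp only [sytCells, Finset.mem_union, Finset.mem_product, Finset.mem_range,
    Finset.mem_singleton, Finset.mem_Ico]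
  tauto

theorem card_sytCells (a i b : ℕ) : (sytCells a i b).card = a + 2 * i + b := by
  rw [sytCells, Finset.card_union_of_disjoint, Finset.card_union_of_disjoint]
  · simp
  all_goals
    rw [Finset.disjoint_left]
    rintro ⟨r, c⟩
    simp only [Finset.mem_union, Finset.mem_product, Finset.mem_range, Finset.mem_singleton,
      Finset.mem_Ico]
    omega

theorem isLowerSet_sytCells {a i b : ℕ} (h : 1 < a ∨ 0 < a ∧ i = 0) :
    IsLowerSet (sytCells a i b : Set (ℕ × ℕ)) := by
  rintro ⟨r, c⟩ ⟨r', c'⟩ hle hmem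
  have hle' := Prod.mk_le_mk.1 hle
  rw [Finset.mem_coe, mem_sytCells] at hmem ⊢
  omega

theorem not_isLowerSet_sytCells_zero {b : ℕ} (hb : b ≠ 0) :
    ¬ IsLowerSet (sytCells 0 0 b : Set (ℕ × ℕ)) := by
  intro h
  have hmem : ((0, 1) : ℕ × ℕ) ∈ (sytCells 0 0 b : Set (ℕ × ℕ)) := by
    rw [Finset.mem_coe, mem_sytCells]; omega
  have hcorner := h (show ((0, 0) : ℕ × ℕ) ≤ (0, 1) by simp) hmem
  rw [Finset.mem_coe, mem_sytCells] at hcorner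
  omega

theorem not_isLowerSet_sytCells_one {i : ℕ} (hi : i ≠ 0) (b : ℕ) :
    ¬ IsLowerSet (sytCells 1 i b : Set (ℕ × ℕ)) := by
  intro h
  have hmem : ((1, 1) : ℕ × ℕ) ∈ (sytCells 1 i b : Set (ℕ × ℕ)) := by
    rw [Finset.mem_coe, mem_sytCells]; omega
  have hcorner := h (show ((1, 0) : ℕ × ℕ) ≤ (1, 1) by simp) hmem
  rw [Finset.mem_coe, mem_sytCells] at hcorner
  omega

theorem erase_sytCells_first (a i b : ℕ) :
    (sytCells (a + 1) i b).erase (a, 0) = sytCells a i b := by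
  ext ⟨r, c⟩
  rw [Finset.mem_erase, mem_sytCells, mem_sytCells, Ne, Prod.mk.injEq]
  omega

theorem erase_sytCells_second {i : ℕ} (hi : i ≠ 0) (a b : ℕ) :
    (sytCells a i b).erase (1, i) = sytCells a (i - 1) (b + 1) := by
  ext ⟨r, c⟩
  rw [Finset.mem_erase, mem_sytCells, mem_sytCells, Ne, Prod.mk.injEq]
  omega

theorem erase_sytCells_third {b : ℕ} (hb : b ≠ 0) (a i : ℕ) :
    (sytCells a i b).erase (0, i + b) = sytCells a i (b - 1) := by
  ext ⟨r, c⟩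
  rw [Finset.mem_erase, mem_sytCells, mem_sytCells, Ne, Prod.mk.injEq]
  omega

theorem mem_Syt_iff {a i b : ℕ} {T : ℕ × ℕ → ℕ} :
    T ∈ Syt a i b ↔ IsStandardLabeling (sytCells a i b) T := by
  constructor
  · rintro ⟨hlow, hzero, hbij, hrow, hcol⟩
    refine ⟨hlow, hzero, by rwa [card_sytCells], ?_⟩
    rintro ⟨r, c⟩ - ⟨r', c'⟩ hmem hlt
    have hmem₂ : (r, c') ∈ sytCells a i b := hlow (Prod.mk_le_mk.2 ⟨hlt.le.1, le_rfl⟩) hmem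
    have hmem₁ : (r, c) ∈ sytCells a i b := hlow hlt.le hmem
    rcases hlt.le.1.lt_or_eq with hr | rfl
    · rcases hlt.le.2.lt_or_eq with hc | rfl
      · exact (hrow _ _ _ hc hmem₁ hmem₂).trans (hcol _ _ _ hr hmem₂ hmem)
      · exact hcol _ _ _ hr hmem₁ hmem
    · exact hrow _ _ _ (lt_of_le_of_ne hlt.le.2 fun hc => hlt.ne (by rw [hc])) hmem₁ hmem
  · rintro ⟨hlow, hzero, hbij, hmono⟩
    rw [card_sytCells] at hbij
    exact ⟨hlow, hzero, hbij,
      fun r c c' hc h h' => hmono h h' (Prod.mk_lt_mk.2 (Or.inr ⟨le_rfl, hc⟩)),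
      fun r r' c hr h h' => hmono h h' (Prod.mk_lt_mk.2 (Or.inl ⟨hr, le_rfl⟩))⟩

theorem syt_eq_ncard (a i b : ℕ) :
    syt a i b = {T | IsStandardLabeling (sytCells a i b) T}.ncard :=
  congrArg Set.ncard (Set.ext fun _ => mem_Syt_iff)

theorem syt_eq_zero {a i b : ℕ} (h : ¬ IsLowerSet (sytCells a i b : Set (ℕ × ℕ))) :
    syt a i b = 0 := by
  have hempty : Syt a i b = ∅ := Set.eq_empty_of_forall_notMem fun T hT => h hT.1
  rw [syt, hempty, Set.ncard_empty]

theorem sytBar_eq_zero {a i b : ℕ} (h : ¬ IsLowerSet (sytCells a i b : Set (ℕ × ℕ))) :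
    sytBar a i b = 0 := by
  have hempty : SytBar a i b = ∅ := Set.eq_empty_of_forall_notMem fun T hT => h hT.1.1
  rw [sytBar, hempty, Set.ncard_empty]

theorem syt_zero_zero_zero : syt 0 0 0 = 1 := by
  have hcells : sytCells 0 0 0 = ∅ := rfl
  have hempty : {T : ℕ × ℕ → ℕ | IsStandardLabeling ∅ T} = {0} := by
    refine Set.eq_singleton_iff_unique_mem.2 ⟨⟨?_, fun _ _ => rfl, ?_, ?_⟩, fun T hT => ?_⟩
    · rw [Finset.coe_empty]
      exact isLowerSet_empty
    · simp
    · simp [StrictMonoOn]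
    · exact funext fun c => hT.eq_zero c (Finset.notMem_empty c)
  rw [syt_eq_ncard, hcells, hempty, Set.ncard_singleton]

/-- The boxes at the bottom of the columns with index `0` and `i` of the diagram
`sytCells (a + 1) i b`; the second one is a corner of its own only for `i ≠ 0`. -/
def leftCorners (a i : ℕ) : Finset (ℕ × ℕ) :=
  {(a, 0)} ∪ if i = 0 then ∅ else {(1, i)}

theorem mem_leftCorners {a i r c : ℕ} :
    (r, c) ∈ leftCorners a i ↔ (r = a ∧ c = 0) ∨ (i ≠ 0 ∧ r = 1 ∧ c = i) := by
  rw [leftCorners]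
  split_ifs with hi <;> simp [hi]

theorem leftCorners_subset {a i : ℕ} (b : ℕ) : leftCorners a i ⊆ sytCells (a + 1) i b := by
  rintro ⟨r, c⟩ h
  rw [mem_leftCorners] at h
  rw [mem_sytCells]
  omega

theorem sum_leftCorners (a i b : ℕ) :
    ∑ c ∈ leftCorners a i, {T | IsStandardLabeling ((sytCells (a + 1) i b).erase c) T}.ncard =
      syt a i b + if i = 0 then 0 else syt (a + 1) (i - 1) (b + 1) := by
  rw [leftCorners]
  split_ifs with hi
  · rw [Finset.union_empty, Finset.sum_singleton, erase_sytCells_first, add_zero, syt_eq_ncard]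
  · rw [Finset.sum_union (by simp [Ne.symm hi]), Finset.sum_singleton, Finset.sum_singleton,
      erase_sytCells_first, erase_sytCells_second hi, syt_eq_ncard, syt_eq_ncard]

theorem syt_succ {a i : ℕ} (h : a ≠ 0 ∨ i = 0) (b : ℕ) :
    syt (a + 1) i b = syt a i b + (if i = 0 then 0 else syt (a + 1) (i - 1) (b + 1)) +
      if b = 0 then 0 else syt (a + 1) i (b - 1) := by
  let lastCorner : Finset (ℕ × ℕ) := if b = 0 then ∅ else {(0, i + b)}
  have hlast : ∀ {r c}, (r, c) ∈ lastCorner ↔ b ≠ 0 ∧ r = 0 ∧ c = i + b := by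
    intro r c
    simp only [lastCorner]
    split_ifs with hb <;> simp [hb]
  have hdisj : Disjoint (leftCorners a i) lastCorner := by
    rw [Finset.disjoint_left]
    rintro ⟨r, c⟩
    rw [mem_leftCorners, hlast]
    omega
  have hsub : leftCorners a i ∪ lastCorner ⊆ sytCells (a + 1) i b := by
    refine Finset.union_subset (leftCorners_subset b) ?_
    rintro ⟨r, c⟩
    rw [hlast, mem_sytCells]
    omega
  have hmax : ∀ d ∈ sytCells (a + 1) i b, d ∉ leftCorners a i ∪ lastCorner →
      ∃ e ∈ sytCells (a + 1) i b, d < e := by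
    rintro ⟨r, c⟩ hd hS
    rw [Finset.mem_union, mem_leftCorners, hlast] at hS
    rw [mem_sytCells] at hd
    suffices (r + 1, c) ∈ sytCells (a + 1) i b ∨ (r, c + 1) ∈ sytCells (a + 1) i b from
      this.elim (fun he => ⟨_, he, by simp [Prod.mk_lt_mk]⟩)
        fun he => ⟨_, he, by simp [Prod.mk_lt_mk]⟩
    rw [mem_sytCells, mem_sytCells]
    rcases hd with hd | hd | hd <;> omega
  have hne : (sytCells (a + 1) i b).Nonempty := ⟨(0, 0), by rw [mem_sytCells]; omega⟩
  rw [syt_eq_ncard, IsStandardLabeling.ncard_setOf (isLowerSet_sytCells (by omega)) hne hsub hmax,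
    Finset.sum_union hdisj, sum_leftCorners]
  congr 1
  simp only [lastCorner]
  split_ifs with hb
  · rw [Finset.sum_empty]
  · rw [Finset.sum_singleton, erase_sytCells_third hb, syt_eq_ncard]

theorem sytBar_succ {a i : ℕ} (h : a ≠ 0 ∨ i = 0) (b : ℕ) :
    sytBar (a + 1) i b = syt a i b + if i = 0 then 0 else syt (a + 1) (i - 1) (b + 1) := by
  rw [← sum_leftCorners, ← IsStandardLabeling.ncard_setOf_exists_mem
    (isLowerSet_sytCells (by omega)) (leftCorners_subset b), sytBar]
  congr 1
  ext T
  have hcorner : ∀ r c, (c = 0 ∨ c = i) ∧ (r, c) ∈ sytCells (a + 1) i b ∧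
      (r + 1, c) ∉ sytCells (a + 1) i b ↔ (r, c) ∈ leftCorners a i := by
    intro r c
    rw [mem_sytCells, mem_sytCells, mem_leftCorners]
    omega
  simp only [SytBar, Set.mem_ofPred_eq, mem_Syt_iff, Prod.exists, card_sytCells, ← hcorner,
    and_assoc]

theorem syt_one_zero (b : ℕ) : syt 1 0 b = 1 := by
  induction b with
  | zero => rw [syt_succ (Or.inr rfl), if_pos rfl, if_pos rfl, syt_zero_zero_zero]
  | succ b ih =>
    rw [syt_succ (Or.inr rfl), if_pos rfl, if_neg b.succ_ne_zero, Nat.add_sub_cancel, ih,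
      syt_eq_zero (not_isLowerSet_sytCells_zero b.succ_ne_zero)]

theorem syt_one {i : ℕ} (hi : i ≠ 0) (b : ℕ) : syt 1 i b = 0 :=
  syt_eq_zero (not_isLowerSet_sytCells_one hi b)

theorem sytBar_one {i b : ℕ} (h : i ≠ 0 ∨ b ≠ 0) : sytBar 1 i b = 0 := by
  by_cases hi : i = 0
  · rw [sytBar_succ (Or.inr hi), if_pos hi, hi,
      syt_eq_zero (not_isLowerSet_sytCells_zero (h.resolve_left (not_not.2 hi)))]
  · exact sytBar_eq_zero (not_isLowerSet_sytCells_one hi b)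

theorem syt_zero_pos (a b : ℕ) : 0 < syt (a + 1) 0 b := by
  induction a with
  | zero => rw [syt_one_zero]; exact one_pos
  | succ a ih => rw [syt_succ (Or.inr rfl)]; omega

theorem syt_pos (a i b : ℕ) : 0 < syt (a + 2) i b := by
  induction i generalizing b with
  | zero => exact syt_zero_pos (a + 1) b
  | succ i ih =>
    have hpos : 0 < syt (a + 1 + 1) i (b + 1) := ih (b + 1)
    rw [syt_succ (a := a + 1) (Or.inl a.succ_ne_zero), if_neg i.succ_ne_zero, Nat.add_sub_cancel]
    omega

theorem sytBar_pos (a i b : ℕ) : 0 < sytBar (a + 2) i b := by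
  rw [sytBar_succ (Or.inl a.succ_ne_zero)]
  split_ifs with hi
  · rw [hi, add_zero]
    exact syt_zero_pos a b
  · exact Nat.add_pos_right _ (syt_pos a (i - 1) (b + 1))

end Tableaux

section SignsAndReflection

theorem coeff_neg_one_pow_mul (n : ℕ) (p : ℤ[X]) (i : ℕ) :
    ((-1) ^ n * p).coeff i = (-1) ^ n * p.coeff i := by
  rcases Nat.even_or_odd n with hn | hn <;> simp [hn]

theorem reflect_neg_one_pow_mul (n d : ℕ) (p : ℤ[X]) :
    reflect d ((-1) ^ n * p) = (-1) ^ n * reflect d p := by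
  ext i
  rw [coeff_reflect, coeff_neg_one_pow_mul, coeff_neg_one_pow_mul, coeff_reflect]

theorem natDegree_neg_one_pow_mul (n : ℕ) (p : ℤ[X]) :
    ((-1) ^ n * p).natDegree = p.natDegree := by
  rcases Nat.even_or_odd n with hn | hn <;> simp [hn]

theorem reflect_sum {ι : Type*} (s : Finset ι) (f : ι → ℤ[X]) (d : ℕ) :
    reflect d (∑ j ∈ s, f j) = ∑ j ∈ s, reflect d (f j) := by
  ext i
  simp only [coeff_reflect, finsetSum_coeff]

end SignsAndReflection

section TruncatedBinomial

/-- The expansion of `(1 - (1 + X)) ^ n = (-X) ^ n` in powers of `1 + X`, cut off after `k` terms.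
The Kazhdan–Lusztig recursions of uniform matroids and of relaxations, and the recursions
for tableaux, are all solved in terms of these polynomials. -/
def truncBinomial (n k : ℕ) : ℤ[X] :=
  ∑ m ∈ Finset.range k, (-1) ^ m * (n.choose m : ℤ[X]) * (1 + X) ^ m

theorem truncBinomial_succ (n k : ℕ) :
    truncBinomial n (k + 1) =
      truncBinomial n k + (-1) ^ k * (n.choose k : ℤ[X]) * (1 + X) ^ k :=
  Finset.sum_range_succ _ _

theorem truncBinomial_self_succ (n : ℕ) : truncBinomial n (n + 1) = (-X) ^ n := by
  rw [show (-X : ℤ[X]) = -(1 + X) + 1 by ring, add_pow, truncBinomial]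
  refine Finset.sum_congr rfl fun m _ => ?_
  rw [neg_pow (1 + X : ℤ[X])]
  ring

theorem truncBinomial_self (n : ℕ) :
    truncBinomial n n = (-X) ^ n - (-1) ^ n * (1 + X) ^ n := by
  rw [← truncBinomial_self_succ, truncBinomial_succ, Nat.choose_self, Nat.cast_one]
  ring

theorem truncBinomial_succ_succ (n k : ℕ) :
    truncBinomial (n + 1) (k + 1) =
      truncBinomial n (k + 1) - (1 + X) * truncBinomial n k := by
  simp only [truncBinomial]
  rw [Finset.sum_range_succ', Finset.sum_range_succ' _ k, Finset.mul_sum, add_sub_right_comm,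
    ← Finset.sum_sub_distrib]
  congr 1
  · refine Finset.sum_congr rfl fun m _ => ?_
    rw [Nat.choose_succ_succ', Nat.cast_add]
    ring
  · simp

theorem coeff_sign_mul_choose_mul (n k m i : ℕ) :
    ((-1) ^ m * (n.choose k : ℤ[X]) * (1 + X) ^ m).coeff i =
      (-1 : ℤ) ^ m * n.choose k * m.choose i := by
  rw [mul_assoc, coeff_neg_one_pow_mul, coeff_natCast_mul, coeff_one_add_X_pow, mul_assoc]

theorem coeff_truncBinomial_of_le {n k i : ℕ} (h : k ≤ i) : (truncBinomial n k).coeff i = 0 := by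
  rw [truncBinomial, finsetSum_coeff]
  refine Finset.sum_eq_zero fun m hm => ?_
  rw [coeff_sign_mul_choose_mul, Nat.choose_eq_zero_of_lt ((Finset.mem_range.1 hm).trans_le h),
    Nat.cast_zero, mul_zero]

theorem coeff_truncBinomial_self {k i : ℕ} (hi : i < k) :
    (truncBinomial k k).coeff i = -(-1) ^ k * k.choose i := by
  rw [truncBinomial_self, neg_pow, coeff_sub, coeff_neg_one_pow_mul, coeff_neg_one_pow_mul,
    coeff_X_pow, if_neg hi.ne, coeff_one_add_X_pow]
  ring

theorem coeff_truncBinomial_succ_succ_zero (n k : ℕ) :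
    (truncBinomial (n + 1) (k + 1)).coeff 0 =
      (truncBinomial n (k + 1)).coeff 0 - (truncBinomial n k).coeff 0 := by
  rw [truncBinomial_succ_succ, coeff_sub, mul_coeff_zero]
  simp

theorem coeff_truncBinomial_succ_succ_succ (n k i : ℕ) :
    (truncBinomial (n + 1) (k + 1)).coeff (i + 1) = (truncBinomial n (k + 1)).coeff (i + 1) -
      ((truncBinomial n k).coeff (i + 1) + (truncBinomial n k).coeff i) := by
  rw [truncBinomial_succ_succ, coeff_sub, one_add_mul, coeff_add, coeff_X_mul]

theorem syt_one_eq_coeff_truncBinomial {k i : ℕ} (hik : 2 * i < k) :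
    (syt 1 i (k - 2 * i - 1) : ℤ) =
      (-1) ^ (k + 1) * ((truncBinomial k k).coeff i - (truncBinomial k k).coeff (k - i)) := by
  have hsign : (-1 : ℤ) ^ k * (-1) ^ k = 1 := by rw [← mul_pow]; norm_num
  rw [coeff_truncBinomial_self (by omega), pow_succ]
  by_cases hi : i = 0
  · rw [hi, syt_one_zero, coeff_truncBinomial_of_le (Nat.sub_zero k).ge, Nat.choose_zero_right]
    linear_combination -hsign
  · rw [syt_one hi, coeff_truncBinomial_self (by omega), Nat.choose_symm (by omega)]
    ring

-- The recursion for tableaux is Pascal's rule for the coefficients of `X ^ i` and `X ^ (k - i)`;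
-- their difference vanishes for `k = 2 * i`, where the last term of the recursion is missing.
theorem syt_eq_coeff_truncBinomial {n k i : ℕ} (hkn : k ≤ n) (hik : 2 * i < k) :
    (syt (n - k + 1) i (k - 2 * i - 1) : ℤ) =
      (-1) ^ (k + 1) * ((truncBinomial n k).coeff i - (truncBinomial n k).coeff (k - i)) := by
  induction n generalizing k i with
  | zero => omega
  | succ n ih =>
    rcases hkn.eq_or_lt with rfl | hlt
    · rw [Nat.sub_self, syt_one_eq_coeff_truncBinomial hik]
    obtain ⟨k, rfl⟩ : ∃ l, k = l + 1 := ⟨k - 1, by omega⟩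
    have hfirst := ih (k := k + 1) (i := i) (by omega) hik
    have hlast : ((if k + 1 - 2 * i - 1 = 0 then 0
        else syt (n - k + 1) i (k + 1 - 2 * i - 1 - 1) : ℕ) : ℤ) =
        (-1) ^ (k + 1) * ((truncBinomial n k).coeff i - (truncBinomial n k).coeff (k - i)) := by
      split_ifs with hb
      · rw [show k - i = i by omega]
        simp
      · rw [← ih (k := k) (by omega) (by omega),
          show k + 1 - 2 * i - 1 - 1 = k - 2 * i - 1 by omega]
    rw [show n - (k + 1) + 1 = n - k by omega] at hfirst
    rw [Nat.add_sub_add_right, syt_succ (Or.inl (by omega)), Nat.cast_add, Nat.cast_add, hlast,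
      hfirst, show k + 1 - i = k - i + 1 by omega, coeff_truncBinomial_succ_succ_succ]
    cases i with
    | zero =>
      rw [if_pos rfl, coeff_truncBinomial_succ_succ_zero,
        coeff_truncBinomial_of_le (n := n) (k := k) (i := k - 0 + 1) (by omega)]
      push_cast
      ring
    | succ i =>
      have hsecond := ih (k := k) (i := i) (by omega) (by omega)
      rw [show k - 2 * i - 1 = k + 1 - 2 * (i + 1) - 1 + 1 by omega,
        show k - i = k - (i + 1) + 1 by omega] at hsecond
      rw [if_neg i.succ_ne_zero, Nat.add_sub_cancel, hsecond, coeff_truncBinomial_succ_succ_succ]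
      ring

theorem sytBar_eq_coeff_truncBinomial {h k i : ℕ} (hkh : k ≤ h) (hik : 2 * i < k) :
    (sytBar (h + 2 - k) i (k - 2 * i - 1) : ℤ) =
      (-1) ^ (k + 1) * ((1 - X) * truncBinomial h k).coeff i := by
  have hfirst := syt_eq_coeff_truncBinomial hkh hik
  rw [show h + 2 - k = h - k + 1 + 1 by omega, sytBar_succ (Or.inl (by omega)), Nat.cast_add,
    hfirst, one_sub_mul, coeff_sub]
  cases i with
  | zero =>
    rw [if_pos rfl, coeff_truncBinomial_of_le (Nat.sub_zero k).ge, coeff_X_mul_zero, Nat.cast_zero,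
      add_zero]
  | succ i =>
    obtain ⟨k, rfl⟩ : ∃ l, k = l + 1 := ⟨k - 1, by omega⟩
    have hsecond := syt_eq_coeff_truncBinomial (n := h) (k := k) (i := i) (by omega) (by omega)
    have hchoose : k.choose (k - i) = k.choose i := Nat.choose_symm (by omega)
    rw [show h - k + 1 = h - (k + 1) + 1 + 1 by omega,
      show k - 2 * i - 1 = k + 1 - 2 * (i + 1) - 1 + 1 by omega] at hsecond
    rw [if_neg i.succ_ne_zero, Nat.add_sub_cancel, hsecond, coeff_X_mul, truncBinomial_succ,
      coeff_add, coeff_add, coeff_add, coeff_sign_mul_choose_mul, coeff_sign_mul_choose_mul,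
      coeff_sign_mul_choose_mul, show k + 1 - (i + 1) = k - i by omega, hchoose]
    ring

end TruncatedBinomial

section Rank

variable {α : Type u} (M : Matroid α)

theorem rk_empty : rk M ∅ = 0 := by
  rw [rk, M.eRk_empty, ENat.toNat_zero]

theorem rk_closure (X : Set α) : rk M (M.closure X) = rk M X := by
  rw [rk, M.eRk_closure_eq, rk]

theorem rk_restrict {R X : Set α} (h : X ⊆ R) : rk (M.restrict R) X = rk M X := by
  rw [rk, M.restrict_eRk_eq h, rk]

theorem rank_restrict (R : Set α) : rank (M.restrict R) = rk M R :=
  rk_restrict M subset_rfl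

theorem isFlat_restrict_iff {F G : Set α} (hF : M.IsFlat F) :
    (M.restrict F).IsFlat G ↔ M.IsFlat G ∧ G ⊆ F := by
  refine ⟨fun hG => ?_, fun ⟨hG, hGF⟩ => ?_⟩
  · have hGF : G ⊆ F := hG.subset_ground
    have hcl : M.closure G ⊆ F := hF.closure ▸ M.closure_subset_closure hGF
    rw [Matroid.isFlat_iff_closure_eq, M.restrict_closure_eq hGF hF.subset_ground,
      Set.inter_eq_left.2 hcl] at hG
    exact ⟨M.isFlat_iff_closure_eq.2 hG, hGF⟩
  · rw [Matroid.isFlat_iff_closure_eq, M.restrict_closure_eq hGF hF.subset_ground, hG.closure,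
      Set.inter_eq_left.2 hGF]

theorem closure_subset_iff {F X : Set α} (hF : M.IsFlat F) (hX : X ⊆ M.E) :
    M.closure X ⊆ F ↔ X ⊆ F :=
  ⟨(M.subset_closure X hX).trans, fun h => hF.closure ▸ M.closure_subset_closure h⟩

variable [Finite α]

theorem coe_rk (X : Set α) : (rk M X : ℕ∞) = M.eRk X :=
  ENat.natCast_toNat (ne_top_of_le_ne_top (Set.toFinite X).encard_lt_top.ne (M.eRk_le_encard X))

theorem rk_le_ncard (X : Set α) : rk M X ≤ X.ncard := by
  rw [← Nat.cast_le (α := ℕ∞), coe_rk, (Set.toFinite X).cast_ncard_eq]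
  exact M.eRk_le_encard X

theorem rk_mono {X Y : Set α} (h : X ⊆ Y) : rk M X ≤ rk M Y := by
  rw [← Nat.cast_le (α := ℕ∞), coe_rk, coe_rk]
  exact M.eRk_mono h

theorem rk_le_rank (X : Set α) : rk M X ≤ rank M := by
  rw [rank, ← Nat.cast_le (α := ℕ∞), coe_rk, coe_rk, M.eRk_ground]
  exact M.eRk_le_eRank X

theorem indep_iff_rk {I : Set α} : M.Indep I ↔ rk M I = I.ncard := by
  rw [Matroid.indep_iff_eRk_eq_encard_of_finite (Set.toFinite I), ← coe_rk,
    ← (Set.toFinite I).cast_ncard_eq, Nat.cast_inj]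

theorem rk_contract_sdiff_add {C X : Set α} (hCX : C ⊆ X) (hX : X ⊆ M.E) :
    rk (M.contract C) (X \ C) + rk M C = rk M X := by
  obtain ⟨J, hJ⟩ := M.exists_isBasis C (hCX.trans hX)
  obtain ⟨I, hI, hJI⟩ := hJ.indep.subset_isBasis_of_subset (hJ.subset.trans hCX) hX
  have hcontract : (M.contract C).eRk (X \ C) = (I \ J).encard := by
    rw [hJ.contract_eq_contract_delete, Matroid.delete, Matroid.restrict_eRk_eq,
      (hJ.contract_sdiff_isBasis_sdiff hI hJI).encard_eq_eRk]
    rw [Matroid.contract_ground, Set.sdiff_sdiff, Set.union_sdiff_self,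
      Set.union_eq_self_of_subset_left hJ.subset]
    exact Set.sdiff_subset_sdiff_left hX
  rw [← Nat.cast_inj (R := ℕ∞), Nat.cast_add, coe_rk, coe_rk, coe_rk, hcontract,
    ← hJ.encard_eq_eRk, ← hI.encard_eq_eRk, Set.encard_sdiff_add_encard_of_subset hJI]

theorem rank_contract_add {C : Set α} (hC : C ⊆ M.E) :
    rank (M.contract C) + rk M C = rank M :=
  rk_contract_sdiff_add M hC subset_rfl

theorem isFlat_iff_rk {F : Set α} :
    M.IsFlat F ↔ F ⊆ M.E ∧ ∀ e ∈ M.E \ F, rk M (insert e F) = rk M F + 1 := by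
  constructor
  · refine fun hF => ⟨hF.subset_ground, fun e he => ?_⟩
    rw [← Nat.cast_inj (R := ℕ∞), Nat.cast_add, coe_rk, coe_rk]
    exact M.eRk_insert_eq_add_one (by rwa [hF.closure])
  · rintro ⟨hFE, hrk⟩
    rw [Matroid.isFlat_iff_closure_eq]
    refine (M.subset_closure F hFE).antisymm' fun e he => ?_
    by_contra heF
    have hlt := hrk e ⟨M.closure_subset_ground F he, heF⟩
    have hle := rk_mono M (Set.insert_subset he (M.subset_closure F hFE))
    rw [rk_closure] at hle
    omega

theorem rk_lt_rank_of_isFlat {F : Set α} (hF : M.IsFlat F) (hne : F ≠ M.E) :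
    rk M F < rank M := by
  obtain ⟨e, he, heF⟩ := Set.exists_of_ssubset (hF.subset_ground.ssubset_of_ne hne)
  have hsucc := ((isFlat_iff_rk M).1 hF).2 e ⟨he, heF⟩
  have hle := rk_le_rank M (insert e F)
  omega

theorem eq_of_rk_eq {M N : Matroid α} (hE : M.E = N.E) (h : ∀ X ⊆ M.E, rk M X = rk N X) :
    M = N := by
  refine Matroid.ext_indep hE fun I hI => ?_
  rw [indep_iff_rk, indep_iff_rk, h I hI]

end Rank

section Subsets

open Finset

open scoped Classical

variable {α : Type u} [Finite α]

attribute [local instance] Fintype.ofFinite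

variable (M : Matroid α)

theorem sum_moebius_left (F G : Flats M) :
    ∑ K : Flats M with F ≤ K ∧ K ≤ G, moebius M K G = if F = G then 1 else 0 := by
  let _ : Fintype (Flats M) := Fintype.ofFinite _
  let _ : LocallyFiniteOrder (Flats M) := Fintype.toLocallyFiniteOrder
  refine Eq.trans (sum_congr ?_ fun K _ => rfl) (IncidenceAlgebra.sum_Icc_mu_left F G)
  ext K
  simp only [mem_filter_univ, mem_Icc]

attribute [local instance] Fintype.toLocallyFiniteOrder

theorem sum_Icc_sdiff {R : Type*} [AddCommMonoid R] {F G : Set α} (h : F ⊆ G) (f : Set α → R) :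
    ∑ A ∈ Icc F G, f (A \ F) = ∑ B ∈ Icc ∅ (G \ F), f B := by
  refine sum_bij' (fun A _ => A \ F) (fun B _ => B ∪ F) (fun A hA => ?_) (fun B hB => ?_)
    (fun A hA => Set.sdiff_union_of_subset (mem_Icc.1 hA).1) (fun B hB => ?_) fun _ _ => rfl
  · exact mem_Icc.2 ⟨Set.empty_subset _, Set.sdiff_subset_sdiff_left (mem_Icc.1 hA).2⟩
  · exact mem_Icc.2 ⟨Set.subset_union_right,
      Set.union_subset ((mem_Icc.1 hB).2.trans Set.sdiff_subset) h⟩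
  · have hdisj : Disjoint B F := Set.disjoint_sdiff_left.mono_left (mem_Icc.1 hB).2
    rw [Set.union_sdiff_right, hdisj.sdiff_eq_left]

theorem sum_Icc_empty_ncard {R : Type*} [AddCommMonoid R] (S : Set α) (f : ℕ → R) :
    ∑ A ∈ Icc ∅ S, f A.ncard = ∑ m ∈ range (S.ncard + 1), S.ncard.choose m • f m := by
  rw [Set.ncard_eq_toFinset_card', ← sum_powerset_apply_card]
  refine (sum_bij' (fun (B : Finset α) _ => (B : Set α)) (fun A _ => A.toFinset) ?_ ?_
    (fun B _ => by simp) (fun A _ => A.coe_toFinset) ?_).symm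
  · intro B hB
    exact mem_Icc.2 ⟨Set.empty_subset _, fun e he => Set.mem_toFinset.1 (mem_powerset.1 hB he)⟩
  · intro A hA
    exact mem_powerset.2 (Set.toFinset_mono (mem_Icc.1 hA).2)
  · intro B _
    rw [Set.ncard_coe_finset]

theorem sum_Icc_neg_one_pow_ncard {F G : Set α} (h : F ⊆ G) :
    ∑ A ∈ Icc F G, (-1 : ℤ) ^ (A \ F).ncard = if F = G then 1 else 0 := by
  rw [sum_Icc_sdiff h fun B => (-1 : ℤ) ^ B.ncard, sum_Icc_empty_ncard (G \ F) fun m => (-1) ^ m]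
  simp only [nsmul_eq_mul, mul_comm _ ((-1 : ℤ) ^ _)]
  rw [Int.alternating_sum_range_choose]
  refine if_congr ?_ rfl rfl
  rw [Set.ncard_eq_zero, Set.sdiff_eq_empty]
  exact ⟨h.antisymm, fun hFG => hFG ▸ subset_rfl⟩

/-- The characteristic polynomial of the interval between two flats `F` and `G`, as Whitney's
signed sum over the sets between them. -/
def intervalCharPoly (F G : Set α) : ℤ[X] :=
  ∑ A ∈ Icc F G, (-1) ^ (A \ F).ncard * X ^ (rk M G - rk M A)

/-- The polynomial `t ^ d * χ(t⁻¹)` for the characteristic polynomial `χ` of the interval between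
two flats whose ranks differ by `d`. -/
def reverseIntervalCharPoly (F G : Set α) : ℤ[X] :=
  ∑ A ∈ Icc F G, (-1) ^ (A \ F).ncard * X ^ (rk M A - rk M F)

theorem reflect_intervalCharPoly (F G : Set α) :
    reflect (rk M G - rk M F) (intervalCharPoly M F G) = reverseIntervalCharPoly M F G := by
  rw [intervalCharPoly, reverseIntervalCharPoly, reflect_sum]
  refine sum_congr rfl fun A hA => ?_
  have hFA := rk_mono M (mem_Icc.1 hA).1
  have hAG := rk_mono M (mem_Icc.1 hA).2
  rw [reflect_neg_one_pow_mul, reflect_monomial, revAt_le (by omega)]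
  congr 2
  omega

theorem reflect_reverseIntervalCharPoly (F G : Set α) :
    reflect (rk M G - rk M F) (reverseIntervalCharPoly M F G) = intervalCharPoly M F G := by
  ext i
  rw [← reflect_intervalCharPoly, coeff_reflect, coeff_reflect, revAt_invol]

theorem natDegree_reverseIntervalCharPoly_le (F G : Set α) :
    (reverseIntervalCharPoly M F G).natDegree ≤ rk M G - rk M F := by
  refine natDegree_sum_le_of_forall_le _ _ fun A hA => ?_
  rw [natDegree_neg_one_pow_mul, natDegree_X_pow]
  exact Nat.sub_le_sub_right (rk_mono M (mem_Icc.1 hA).2) _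

theorem reverseIntervalCharPoly_self (F : Set α) : reverseIntervalCharPoly M F F = 1 := by
  simp [reverseIntervalCharPoly]

variable {M} in
theorem reverseIntervalCharPoly_congr {N : Matroid α} {F G : Set α} (h : ∀ X ⊆ G, rk M X = rk N X)
    (hFG : F ⊆ G) : reverseIntervalCharPoly M F G = reverseIntervalCharPoly N F G :=
  sum_congr rfl fun A hA => by rw [h A (mem_Icc.1 hA).2, h F hFG]

theorem moebius_eq_sum {F G : Flats M} (hFG : F ≤ G) :
    moebius M F G = ∑ A ∈ Icc F.1 G.1 with M.closure A = G.1, (-1) ^ (A \ F.1).ncard := by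
  have hmem : ∀ (A : Set α) (K : Flats M),
      A ∈ Icc F.1 G.1 ∧ K ∈ ({K | M.closure A ⊆ K.1 ∧ K ≤ G} : Finset (Flats M)) ↔
        A ∈ Icc F.1 K.1 ∧ K ∈ ({K | F ≤ K ∧ K ≤ G} : Finset (Flats M)) := by
    intro A K
    simp only [mem_Icc, mem_filter_univ]
    constructor
    · rintro ⟨⟨hFA, hAG⟩, hAK, hKG⟩
      have hAK' := (closure_subset_iff M K.2 (hAG.trans G.2.subset_ground)).1 hAK
      exact ⟨⟨hFA, hAK'⟩, hFA.trans hAK', hKG⟩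
    · rintro ⟨⟨hFA, hAK⟩, -, hKG⟩
      exact ⟨⟨hFA, hAK.trans hKG⟩, (closure_subset_iff M K.2 (hAK.trans K.2.subset_ground)).2 hAK,
        hKG⟩
  symm
  calc ∑ A ∈ Icc F.1 G.1 with M.closure A = G.1, (-1) ^ (A \ F.1).ncard
      = ∑ A ∈ Icc F.1 G.1, ∑ K : Flats M with M.closure A ⊆ K.1 ∧ K ≤ G,
          (-1) ^ (A \ F.1).ncard * moebius M K G := by
        rw [sum_filter]
        refine sum_congr rfl fun A _ => ?_
        rw [← mul_sum]
        have hmu := sum_moebius_left M ⟨M.closure A, M.isFlat_closure A⟩ G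
        refine Eq.trans ?_ (congrArg _ hmu.symm)
        simp only [Subtype.ext_iff, mul_ite, mul_one, mul_zero]
    _ = ∑ K : Flats M with F ≤ K ∧ K ≤ G, ∑ A ∈ Icc F.1 K.1,
          (-1) ^ (A \ F.1).ncard * moebius M K G :=
        sum_comm' hmem
    _ = ∑ K : Flats M with F ≤ K ∧ K ≤ G, if F = K then moebius M K G else 0 := by
        refine sum_congr rfl fun K hK => ?_
        rw [← sum_mul, sum_Icc_neg_one_pow_ncard ((mem_filter_univ _).1 hK).1, ite_mul, one_mul,
          zero_mul]
        simp only [Subtype.ext_iff]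
    _ = moebius M F G := by
        rw [sum_ite_eq, if_pos ((mem_filter_univ _).2 ⟨le_rfl, hFG⟩)]

theorem sum_flats {R : Type*} [AddCommMonoid R] (p : Set α → Prop) (f : Set α → R) :
    ∑ F : Flats M with p F.1, f F.1 = ∑ F with M.IsFlat F ∧ p F, f F := by
  refine sum_bij' (fun F _ => F.1) (fun F hF => ⟨F, ((mem_filter_univ _).1 hF).1⟩) (fun F hF => ?_)
    (fun F hF => ?_) (fun _ _ => rfl) (fun _ _ => rfl) (fun _ _ => rfl)
  · exact (mem_filter_univ _).2 ⟨F.2, (mem_filter.1 hF).2⟩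
  · exact (mem_filter_univ _).2 ((mem_filter_univ _).1 hF).2

theorem intervalCharPoly_eq_sum_moebius (F : Flats M) :
    intervalCharPoly M F.1 M.E =
      ∑ G : Flats M with F ≤ G, C (moebius M F G) * X ^ (rank M - rk M G.1) := by
  rw [intervalCharPoly, ← sum_fiberwise_of_maps_to (t := ({G | F ≤ G} : Finset (Flats M)))
    (g := fun A => (⟨M.closure A, M.isFlat_closure A⟩ : Flats M))]
  · refine sum_congr rfl fun G hG => ?_
    rw [moebius_eq_sum M ((mem_filter_univ _).1 hG), map_sum, sum_mul]
    refine sum_congr ?_ fun A hA => ?_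
    · ext A
      simp only [mem_filter, mem_Icc, Subtype.ext_iff]
      refine and_congr_left fun hAG => and_congr_right fun _ => ⟨fun hA => ?_, fun hA => ?_⟩
      · exact hAG ▸ M.subset_closure A hA
      · exact hA.trans G.2.subset_ground
    · rw [← (mem_filter.1 hA).2, rk_closure, rank]
      simp
  · intro A hA
    exact (mem_filter_univ _).2 ((mem_Icc.1 hA).1.trans (M.subset_closure A (mem_Icc.1 hA).2))

theorem charPoly_eq_intervalCharPoly (h : M.closure ∅ = ∅) :
    charPoly M = intervalCharPoly M ∅ M.E := by
  have hbot : (botFlat M).1 = ∅ := h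
  rw [← hbot, intervalCharPoly_eq_sum_moebius, charPoly, finsum_eq_sum_of_fintype]
  refine sum_congr (Eq.symm (filter_true_of_mem fun G _ => ?_)) fun _ _ => rfl
  exact Subtype.coe_le_coe.1 (hbot.le.trans (Set.empty_subset _))

theorem charPoly_contract {F : Set α} (hF : M.IsFlat F) :
    charPoly (M.contract F) = intervalCharPoly M F M.E := by
  have hloopless : (M.contract F).closure ∅ = ∅ := by
    have hloops := M.contract_loops_eq F
    rwa [hF.closure, Set.sdiff_self] at hloops
  have hrank := rank_contract_add M hF.subset_ground
  rw [charPoly_eq_intervalCharPoly _ hloopless, intervalCharPoly, intervalCharPoly,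
    Matroid.contract_ground, ← sum_Icc_sdiff hF.subset_ground]
  refine sum_congr rfl fun A hA => ?_
  have hA' := rk_contract_sdiff_add M (mem_Icc.1 hA).1 (mem_Icc.1 hA).2
  rw [Set.sdiff_empty, ← rank, ← Matroid.contract_ground, ← rank]
  congr 2
  omega

theorem sum_intervalCharPoly {F : Set α} (hF : M.IsFlat F) :
    ∑ G with M.IsFlat G ∧ F ⊆ G, intervalCharPoly M G M.E = X ^ (rank M - rk M F) := by
  lift F to Flats M using hF
  calc ∑ G with M.IsFlat G ∧ F.1 ⊆ G, intervalCharPoly M G M.E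
      = ∑ G : Flats M with F ≤ G, ∑ H : Flats M with G ≤ H,
          C (moebius M G H) * X ^ (rank M - rk M H.1) := by
        rw [← sum_flats]
        exact sum_congr rfl fun G _ => intervalCharPoly_eq_sum_moebius M G
    _ = ∑ H : Flats M, ∑ G : Flats M with F ≤ G ∧ G ≤ H,
          C (moebius M G H) * X ^ (rank M - rk M H.1) :=
        sum_comm' (by simp)
    _ = ∑ H : Flats M, if F = H then X ^ (rank M - rk M H.1) else 0 := by
        refine sum_congr rfl fun H _ => ?_
        rw [← sum_mul, ← map_sum, sum_moebius_left]
        split_ifs <;> simp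
    _ = X ^ (rank M - rk M F.1) := by
        rw [sum_ite_eq, if_pos (mem_univ F)]

theorem sum_reverseIntervalCharPoly_mul {F : Set α} (hF : M.IsFlat F) (hne : F ≠ M.E) :
    ∑ G with M.IsFlat G ∧ F ⊆ G, reverseIntervalCharPoly M F G * intervalCharPoly M G M.E = 0 := by
  calc ∑ G with M.IsFlat G ∧ F ⊆ G, reverseIntervalCharPoly M F G * intervalCharPoly M G M.E
      = ∑ G with M.IsFlat G ∧ F ⊆ G, ∑ A ∈ Icc F G,
          (-1) ^ (A \ F).ncard * X ^ (rk M A - rk M F) * intervalCharPoly M G M.E :=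
        sum_congr rfl fun G _ => by rw [reverseIntervalCharPoly, sum_mul]
    _ = ∑ A ∈ Icc F M.E, ∑ G with M.IsFlat G ∧ M.closure A ⊆ G,
          (-1) ^ (A \ F).ncard * X ^ (rk M A - rk M F) * intervalCharPoly M G M.E := by
        refine sum_comm' fun G A => ?_
        simp only [mem_filter_univ, mem_Icc]
        constructor
        · rintro ⟨⟨hG, -⟩, hFA, hAG⟩
          have hAE := hAG.trans hG.subset_ground
          exact ⟨⟨hG, (closure_subset_iff M hG hAE).2 hAG⟩, hFA, hAE⟩
        · rintro ⟨⟨hG, hAG⟩, hFA, hAE⟩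
          have hAG' := (closure_subset_iff M hG hAE).1 hAG
          exact ⟨⟨hG, hFA.trans hAG'⟩, hFA, hAG'⟩
    _ = ∑ A ∈ Icc F M.E, (-1 : ℤ[X]) ^ (A \ F).ncard * X ^ (rank M - rk M F) := by
        refine sum_congr rfl fun A hA => ?_
        have hFA := rk_mono M (mem_Icc.1 hA).1
        have hAE := rk_le_rank M A
        rw [← mul_sum, sum_intervalCharPoly M (M.isFlat_closure A), rk_closure, mul_assoc,
          ← pow_add]
        congr 2
        omega
    _ = 0 := by
        have hsum := congrArg (Int.cast : ℤ → ℤ[X]) (sum_Icc_neg_one_pow_ncard hF.subset_ground)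
        rw [if_neg hne] at hsum
        push_cast at hsum
        rw [← sum_mul, hsum, zero_mul]

theorem sum_proper_reverseIntervalCharPoly_mul {F : Set α} (hF : M.IsFlat F) (hne : F ≠ M.E) :
    ∑ G with (M.IsFlat G ∧ G ≠ M.E) ∧ F ⊆ G,
      reverseIntervalCharPoly M F G * intervalCharPoly M G M.E =
        -reverseIntervalCharPoly M F M.E := by
  have herase : ({G | (M.IsFlat G ∧ G ≠ M.E) ∧ F ⊆ G} : Finset (Set α)) =
      ({G | M.IsFlat G ∧ F ⊆ G} : Finset (Set α)).erase M.E := by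
    ext G
    simp only [mem_filter_univ, mem_erase]
    tauto
  have hself : intervalCharPoly M M.E M.E = 1 := by simp [intervalCharPoly]
  rw [herase, sum_erase_eq_sub ((mem_filter_univ _).2 ⟨M.ground_isFlat, hF.subset_ground⟩),
    sum_reverseIntervalCharPoly_mul M hF hne, hself, mul_one, zero_sub]

end Subsets

section LowerHalf

/-- The part of a polynomial in degrees less than `r / 2`. -/
def lowerHalf (r : ℕ) (p : ℤ[X]) : ℤ[X] :=
  ∑ i ∈ Finset.range ((r + 1) / 2), C (p.coeff i) * X ^ i

theorem coeff_sum_range_C_mul_X_pow (f : ℕ → ℤ) (n i : ℕ) :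
    (∑ j ∈ Finset.range n, C (f j) * X ^ j).coeff i = if i < n then f i else 0 := by
  simp only [finsetSum_coeff, coeff_C_mul, coeff_X_pow, mul_ite, mul_one, mul_zero,
    Finset.sum_ite_eq, Finset.mem_range]

theorem coeff_lowerHalf (r : ℕ) (p : ℤ[X]) (i : ℕ) :
    (lowerHalf r p).coeff i = if 2 * i < r then p.coeff i else 0 := by
  rw [lowerHalf, coeff_sum_range_C_mul_X_pow]
  exact if_congr (by omega) rfl rfl

theorem natDegree_lowerHalf_lt {r : ℕ} (hr : 0 < r) (p : ℤ[X]) :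
    2 * (lowerHalf r p).natDegree < r := by
  by_contra hcon
  have hzero : lowerHalf r p = 0 := by
    rw [← leadingCoeff_eq_zero, leadingCoeff, coeff_lowerHalf, if_neg hcon]
  rw [hzero, natDegree_zero] at hcon
  omega

-- The hypothesis forces the coefficient in degree `r / 2` to vanish.
theorem lowerHalf_sub_reflect {r : ℕ} {p : ℤ[X]} (hp : reflect r p = -p) :
    lowerHalf r p - reflect r (lowerHalf r p) = p := by
  ext i
  have hcoeff := congrArg (fun q => q.coeff i) hp
  simp only [coeff_reflect, coeff_neg] at hcoeff
  rw [coeff_sub, coeff_reflect, coeff_lowerHalf, coeff_lowerHalf]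
  by_cases hi : i ≤ r
  · rw [revAt_le hi] at hcoeff ⊢
    rcases lt_trichotomy (2 * i) r with hlt | heq | hgt
    · rw [if_pos hlt, if_neg (by omega), sub_zero]
    · rw [if_neg (by omega), if_neg (by omega)]
      rw [show r - i = i by omega] at hcoeff
      omega
    · rw [if_neg (by omega), if_pos (by omega), hcoeff]
      ring
  · rw [revAt_eq_self_of_lt (by omega)] at hcoeff ⊢
    rw [sub_self]
    omega

end LowerHalf

section Existence

open Finset

open scoped Classical

variable {α : Type u} [Finite α]

attribute [local instance] Fintype.ofFinite

theorem finsum_flats (M : Matroid α) (f : Set α → ℤ[X]) :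
    ∑ᶠ F : Flats M, f F.1 = ∑ F with M.IsFlat F, f F := by
  rw [finsum_eq_sum_of_fintype]
  exact (sum_subtype _ (fun F => mem_filter_univ F) f).symm

theorem ncard_lt_of_isFlat {M : Matroid α} {F : Set α} (hF : M.IsFlat F ∧ F ≠ M.E) :
    F.ncard < M.E.ncard :=
  Set.ncard_lt_ncard (hF.1.subset_ground.ssubset_of_ne hF.2) (Set.toFinite _)

/-- The recursion of the inverse Kazhdan–Lusztig polynomials, at a single matroid. -/
def SatisfiesRecursion (Q : Matroid α → ℤ[X]) (M : Matroid α) : Prop :=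
  (-1) ^ rank M * reflect (rank M) (Q M) =
    ∑ᶠ F : Flats M, (-1) ^ rk M F.1 * Q (M.restrict F.1) *
      reflect (rank M - rk M F.1) (charPoly (M.contract F.1))

/-- The terms of the recursion that belong to proper flats. -/
def properSum (Q : Matroid α → ℤ[X]) (M : Matroid α) : ℤ[X] :=
  ∑ F with M.IsFlat F ∧ F ≠ M.E,
    (-1) ^ rk M F * Q (M.restrict F) * reverseIntervalCharPoly M F M.E

theorem satisfiesRecursion_iff_sum_flats {Q : Matroid α → ℤ[X]} {M : Matroid α} :
    SatisfiesRecursion Q M ↔ (-1) ^ rank M * reflect (rank M) (Q M) =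
      ∑ F with M.IsFlat F,
        (-1) ^ rk M F * Q (M.restrict F) * reverseIntervalCharPoly M F M.E := by
  rw [SatisfiesRecursion, finsum_flats M fun F => (-1) ^ rk M F * Q (M.restrict F) *
    reflect (rank M - rk M F) (charPoly (M.contract F))]
  refine Eq.congr_right (sum_congr rfl fun F hF => ?_)
  rw [charPoly_contract M ((mem_filter_univ _).1 hF), rank, reflect_intervalCharPoly]

theorem satisfiesRecursion_iff {Q : Matroid α → ℤ[X]} {M : Matroid α} :
    SatisfiesRecursion Q M ↔
      (-1) ^ rank M * reflect (rank M) (Q M) = (-1) ^ rank M * Q M + properSum Q M := by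
  rw [satisfiesRecursion_iff_sum_flats]
  have herase : ({F | M.IsFlat F ∧ F ≠ M.E} : Finset (Set α)) =
      ({F | M.IsFlat F} : Finset (Set α)).erase M.E := by
    ext F
    simp only [mem_filter_univ, mem_erase, and_comm]
  rw [properSum, herase, ← add_sum_erase _ _ ((mem_filter_univ _).2 M.ground_isFlat),
    reverseIntervalCharPoly_self, Matroid.restrict_ground_eq_self, mul_one, rank]

theorem SatisfiesRecursion.restrict {Q : Matroid α → ℤ[X]} {M : Matroid α} {F : Set α}
    (hF : M.IsFlat F) (h : SatisfiesRecursion Q (M.restrict F)) :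
    (-1) ^ rk M F * reflect (rk M F) (Q (M.restrict F)) =
      ∑ G with M.IsFlat G ∧ G ⊆ F,
        (-1) ^ rk M G * Q (M.restrict G) * reverseIntervalCharPoly M G F := by
  rw [satisfiesRecursion_iff_sum_flats, rank_restrict] at h
  rw [h]
  refine sum_congr (by simp only [isFlat_restrict_iff M hF]) fun G hG => ?_
  have hGF : G ⊆ F := ((mem_filter_univ _).1 hG).2
  rw [rk_restrict M hGF, Matroid.restrict_restrict_eq _ hGF, Matroid.restrict_ground_eq,
    reverseIntervalCharPoly_congr (fun X hX => rk_restrict M hX) hGF]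

theorem reflect_properSum {Q : Matroid α → ℤ[X]} {M : Matroid α}
    (hdeg : ∀ N, (Q N).natDegree ≤ rank N)
    (hrec : ∀ F, M.IsFlat F ∧ F ≠ M.E → SatisfiesRecursion Q (M.restrict F)) :
    reflect (rank M) (properSum Q M) = -properSum Q M := by
  calc reflect (rank M) (properSum Q M)
      = ∑ F with M.IsFlat F ∧ F ≠ M.E, ∑ G with M.IsFlat G ∧ G ⊆ F,
          (-1) ^ rk M G * Q (M.restrict G) *
            (reverseIntervalCharPoly M G F * intervalCharPoly M F M.E) := by
        rw [properSum, reflect_sum]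
        refine sum_congr rfl fun F hF => ?_
        have hF' := (mem_filter_univ _).1 hF
        have hrank : rank M = rk M F + (rank M - rk M F) :=
          (Nat.add_sub_cancel' (rk_le_rank M F)).symm
        have hmul := reflect_mul (Q (M.restrict F)) (reverseIntervalCharPoly M F M.E)
          ((hdeg _).trans (rank_restrict M F).le) (natDegree_reverseIntervalCharPoly_le M F M.E)
        rw [← rank, ← hrank] at hmul
        rw [mul_assoc, reflect_neg_one_pow_mul, hmul, ← mul_assoc, (hrec F hF').restrict hF'.1,
          rank, reflect_reverseIntervalCharPoly, sum_mul]
        exact sum_congr rfl fun G _ => mul_assoc _ _ _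
    _ = ∑ G with M.IsFlat G ∧ G ≠ M.E, ∑ F with (M.IsFlat F ∧ F ≠ M.E) ∧ G ⊆ F,
          (-1) ^ rk M G * Q (M.restrict G) *
            (reverseIntervalCharPoly M G F * intervalCharPoly M F M.E) := by
        refine sum_comm' fun F G => ?_
        simp only [mem_filter_univ]
        refine ⟨fun ⟨hF, hG, hGF⟩ => ⟨⟨hF, hGF⟩, hG, fun hGE => hF.2 ?_⟩,
          fun ⟨⟨hF, hGF⟩, hG, _⟩ => ⟨hF, hG, hGF⟩⟩
        exact hF.1.subset_ground.antisymm (hGE ▸ hGF)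
    _ = -properSum Q M := by
        rw [properSum, ← sum_neg_distrib]
        refine sum_congr rfl fun G hG => ?_
        have hG' := (mem_filter_univ _).1 hG
        rw [← mul_sum, sum_proper_reverseIntervalCharPoly_mul M hG'.1 hG'.2, mul_neg]

/-- The inverse Kazhdan–Lusztig polynomial, by recursion on the ground set: in positive rank, the
recursion determines the lower half of the coefficients through the proper flats. -/
def recursiveKL (M : Matroid α) : ℤ[X] :=
  if rank M = 0 then if M.E = ∅ then 1 else 0
  else (-1) ^ (rank M + 1) *
    lowerHalf (rank M) (∑ F : {F : Set α // M.IsFlat F ∧ F ≠ M.E},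
      (-1) ^ rk M F.1 * recursiveKL (M.restrict F.1) * reverseIntervalCharPoly M F.1 M.E)
termination_by M.E.ncard
decreasing_by exact ncard_lt_of_isFlat F.2

theorem recursiveKL_of_rank_pos {M : Matroid α} (h : 0 < rank M) :
    recursiveKL M = (-1) ^ (rank M + 1) * lowerHalf (rank M) (properSum recursiveKL M) := by
  rw [recursiveKL, if_neg h.ne', properSum, sum_subtype _ fun F => mem_filter_univ F]

theorem two_mul_natDegree_recursiveKL_lt {M : Matroid α} (h : 0 < rank M) :
    2 * (recursiveKL M).natDegree < rank M := by
  rw [recursiveKL_of_rank_pos h, natDegree_neg_one_pow_mul]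
  exact natDegree_lowerHalf_lt h _

theorem natDegree_recursiveKL_le (M : Matroid α) : (recursiveKL M).natDegree ≤ rank M := by
  rcases (rank M).eq_zero_or_pos with h | h
  · rw [recursiveKL, if_pos h]
    split_ifs <;> simp
  · have hdeg := two_mul_natDegree_recursiveKL_lt h
    omega

theorem properSum_of_rank_eq_zero (Q : Matroid α → ℤ[X]) {M : Matroid α} (h : rank M = 0) :
    properSum Q M = 0 := by
  refine sum_eq_zero fun F hF => ?_
  obtain ⟨hflat, hne⟩ := (mem_filter_univ _).1 hF
  have hlt := rk_lt_rank_of_isFlat M hflat hne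
  omega

theorem satisfiesRecursion_recursiveKL (M : Matroid α) : SatisfiesRecursion recursiveKL M := by
  induction hn : M.E.ncard using Nat.strong_induction_on generalizing M with | _ n ih =>
  subst hn
  rw [satisfiesRecursion_iff]
  rcases (rank M).eq_zero_or_pos with h | h
  · rw [properSum_of_rank_eq_zero _ h, h, recursiveKL, if_pos h]
    split_ifs <;> simp
  · have hanti : reflect (rank M) (properSum recursiveKL M) = -properSum recursiveKL M :=
      reflect_properSum natDegree_recursiveKL_le fun F hF => ih _ (ncard_lt_of_isFlat hF) _ rfl
    have hsign : ((-1) ^ rank M * (-1) ^ (rank M + 1) : ℤ[X]) = -1 := by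
      rw [pow_succ, ← mul_assoc, ← mul_pow]
      simp
    rw [recursiveKL_of_rank_pos h, reflect_neg_one_pow_mul]
    linear_combination lowerHalf_sub_reflect hanti +
      (reflect (rank M) (lowerHalf (rank M) (properSum recursiveKL M)) -
        lowerHalf (rank M) (properSum recursiveKL M)) * hsign

theorem isInverseKL_recursiveKL : IsInverseKL (recursiveKL : Matroid α → ℤ[X]) where
  rank_zero_of_empty M h hE := by rw [recursiveKL, if_pos h, if_pos hE]
  rank_zero_of_nonempty M h hE := by rw [recursiveKL, if_pos h, if_neg hE.ne_empty]
  degree_lt M h := two_mul_natDegree_recursiveKL_lt h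
  recursion M := satisfiesRecursion_recursiveKL M

theorem isInverseKL_inverseKL : IsInverseKL (inverseKL : Matroid α → ℤ[X]) :=
  Classical.epsilon_spec (p := fun Q : Matroid α → ℤ[X] => IsInverseKL Q)
    ⟨_, isInverseKL_recursiveKL⟩

end Existence

section BinomialSums

open Finset

open scoped Classical

theorem one_add_X_pow_eq_sum {m k : ℕ} (h : m < k) :
    (1 + X : ℤ[X]) ^ m = ∑ i ∈ range k, (m.choose i : ℤ[X]) * X ^ i := by
  rw [add_comm, add_pow]
  refine sum_subset_zero_on_sdiff (range_mono h) (fun i hi => ?_) fun i _ => ?_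
  · rw [mem_sdiff, mem_range, mem_range] at hi
    rw [Nat.choose_eq_zero_of_lt (by omega), Nat.cast_zero, zero_mul]
  · rw [one_pow, mul_one, mul_comm]

theorem reflect_one_add_X_pow {m k d : ℕ} (hmk : m < k) (hkd : k ≤ d + 1) :
    reflect d ((1 + X : ℤ[X]) ^ m) = ∑ i ∈ range k, (m.choose i : ℤ[X]) * X ^ (d - i) := by
  rw [one_add_X_pow_eq_sum hmk, reflect_sum]
  refine sum_congr rfl fun i hi => ?_
  rw [← C_eq_natCast, reflect_C_mul_X_pow, revAt_le (by rw [mem_range] at hi; omega)]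

theorem sum_range_choose_mul_X_pow_sub {m k : ℕ} (h : m < k) :
    ∑ i ∈ range k, (m.choose i : ℤ[X]) * X ^ (m - i) = (1 + X) ^ m := by
  rw [add_pow]
  symm
  refine sum_subset_zero_on_sdiff (range_mono h) (fun i hi => ?_) fun i _ => ?_
  · rw [mem_sdiff, mem_range, mem_range] at hi
    rw [Nat.choose_eq_zero_of_lt (by omega), Nat.cast_zero, zero_mul]
  · rw [one_pow, one_mul, mul_comm]

theorem reflect_one_add_X_pow_self (n : ℕ) : reflect n ((1 + X : ℤ[X]) ^ n) = (1 + X) ^ n := by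
  rw [reflect_one_add_X_pow n.lt_succ_self le_rfl, sum_range_choose_mul_X_pow_sub n.lt_succ_self]

theorem truncBinomial_self_sub_reflect (n : ℕ) :
    truncBinomial n n - reflect n (truncBinomial n n) = (-1) ^ n * (X ^ n - 1) := by
  have hX : reflect n (X ^ n : ℤ[X]) = 1 := by
    rw [reflect_monomial, revAt_le le_rfl, Nat.sub_self, pow_zero]
  rw [truncBinomial_self, neg_pow, ← mul_sub, reflect_neg_one_pow_mul, reflect_sub, hX,
    reflect_one_add_X_pow_self]
  ring

theorem sum_neg_one_pow_mul_choose_mul_choose {i n : ℕ} (h : i < n) :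
    ∑ m ∈ range (n + 1), (-1 : ℤ[X]) ^ m * (n.choose m : ℤ[X]) * (m.choose i : ℤ[X]) = 0 := by
  have hcoeff : ((-X : ℤ[X]) ^ n).coeff i = 0 := by
    rw [neg_pow, coeff_neg_one_pow_mul, coeff_X_pow, if_neg h.ne, mul_zero]
  rw [← truncBinomial_self_succ, truncBinomial, finsetSum_coeff] at hcoeff
  simp only [coeff_sign_mul_choose_mul] at hcoeff
  exact_mod_cast congrArg (Int.cast : ℤ → ℤ[X]) hcoeff

theorem reflect_truncBinomial {n k d : ℕ} (h : k ≤ d + 1) :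
    reflect d (truncBinomial n k) = ∑ m ∈ range k, (n.choose m : ℤ[X]) *
      ((-1) ^ m * ∑ i ∈ range k, (m.choose i : ℤ[X]) * X ^ (d - i)) := by
  rw [truncBinomial, reflect_sum]
  refine sum_congr rfl fun m hm => ?_
  rw [← reflect_one_add_X_pow (mem_range.1 hm) h, mul_assoc, reflect_neg_one_pow_mul,
    ← C_eq_natCast, reflect_C_mul, mul_left_comm]

variable {α : Type u} [Finite α]

attribute [local instance] Fintype.ofFinite

attribute [local instance] Fintype.toLocallyFiniteOrder

theorem sum_Icc_empty_ncard_lt {R : Type*} [Semiring R] (S : Set α) (j : ℕ) (f : ℕ → R) :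
    ∑ A ∈ Icc ∅ S with A.ncard < j, f A.ncard = ∑ i ∈ range j, (S.ncard.choose i : R) * f i := by
  rw [sum_filter, sum_Icc_empty_ncard S fun i => if i < j then f i else 0]
  simp only [nsmul_eq_mul, mul_ite, mul_zero]
  rw [← sum_filter]
  refine sum_subset_zero_on_sdiff (fun i hi => ?_) (fun i hi => ?_) fun _ _ => rfl
  · exact mem_range.2 (mem_filter.1 hi).2
  · simp only [mem_sdiff, mem_filter, mem_range] at hi
    rw [Nat.choose_eq_zero_of_lt (by omega), Nat.cast_zero, zero_mul]

theorem sum_Icc_empty_neg_one_pow_mul {R : Type*} [Ring R] (S : Set α) (p : Set α → Prop)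
    [DecidablePred p] (f : Set α → Set α → R) :
    ∑ F ∈ Icc ∅ S with p F, (-1) ^ F.ncard * ∑ A ∈ Icc F S, (-1) ^ (A \ F).ncard * f F A =
      ∑ A ∈ Icc ∅ S, (-1) ^ A.ncard * ∑ F ∈ Icc ∅ A with p F, f F A := by
  simp only [mul_sum]
  rw [sum_comm' (t' := Icc ∅ S) (s' := fun A => {F ∈ Icc ∅ A | p F})]
  · refine sum_congr rfl fun A _ => sum_congr rfl fun F hF => ?_
    have hFA := (mem_Icc.1 (mem_filter.1 hF).1).2
    rw [← mul_assoc, ← pow_add, add_comm, Set.ncard_sdiff_add_ncard_of_subset hFA]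
  · intro F A
    simp only [mem_filter, mem_Icc]
    exact ⟨fun ⟨⟨⟨hF, _⟩, hp⟩, hFA, hAS⟩ => ⟨⟨⟨hF, hFA⟩, hp⟩, Set.empty_subset A, hAS⟩,
      fun ⟨⟨⟨hF, hFA⟩, hp⟩, _, hAS⟩ => ⟨⟨⟨hF, hFA.trans hAS⟩, hp⟩, hFA, hAS⟩⟩

theorem sum_ncard_lt_eq_truncBinomial (S : Set α) (k : ℕ) :
    ∑ A ∈ Icc ∅ S with A.ncard < k,
      (-1) ^ A.ncard * ∑ F ∈ Icc ∅ A with F.ncard < k, X ^ (A.ncard - F.ncard) =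
        truncBinomial S.ncard k := by
  rw [truncBinomial, ← sum_congr rfl fun m _ => (mul_left_comm _ _ _).trans (mul_assoc _ _ _).symm,
    ← sum_Icc_empty_ncard_lt S k fun m => (-1) ^ m * (1 + X : ℤ[X]) ^ m]
  refine sum_congr rfl fun A hA => ?_
  rw [sum_Icc_empty_ncard_lt A k fun i => (X : ℤ[X]) ^ (A.ncard - i),
    sum_range_choose_mul_X_pow_sub (mem_filter.1 hA).2]

theorem sum_le_ncard_eq_neg_reflect_truncBinomial {S : Set α} {k d : ℕ} (hk : k ≤ S.ncard)
    (hd : k ≤ d + 1) :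
    ∑ A ∈ Icc ∅ S with ¬ A.ncard < k,
      (-1) ^ A.ncard * ∑ F ∈ Icc ∅ A with F.ncard < k, X ^ (d - F.ncard) =
        -reflect d (truncBinomial S.ncard k) := by
  have hinner : ∀ A : Set α, (-1) ^ A.ncard * ∑ F ∈ Icc ∅ A with F.ncard < k, X ^ (d - F.ncard) =
      (-1) ^ A.ncard * ∑ i ∈ range k, (A.ncard.choose i : ℤ[X]) * X ^ (d - i) := fun A => by
    rw [sum_Icc_empty_ncard_lt A k fun i => (X : ℤ[X]) ^ (d - i)]
  have htotal : ∑ A ∈ Icc ∅ S, (-1) ^ A.ncard *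
      ∑ i ∈ range k, (A.ncard.choose i : ℤ[X]) * X ^ (d - i) = 0 := by
    rw [sum_Icc_empty_ncard S fun m => (-1) ^ m * ∑ i ∈ range k, (m.choose i : ℤ[X]) * X ^ (d - i)]
    simp only [nsmul_eq_mul, mul_sum]
    rw [sum_comm]
    refine sum_eq_zero fun i hi => ?_
    have hzero := sum_neg_one_pow_mul_choose_mul_choose ((mem_range.1 hi).trans_le hk)
    rw [← zero_mul (X ^ (d - i) : ℤ[X]), ← hzero, sum_mul]
    exact sum_congr rfl fun m _ => by ring
  rw [← sum_filter_add_sum_filter_not _ fun A : Set α => A.ncard < k, sum_Icc_empty_ncard_lt S k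
    fun m => (-1) ^ m * ∑ i ∈ range k, (m.choose i : ℤ[X]) * X ^ (d - i),
    ← reflect_truncBinomial hd] at htotal
  rw [sum_congr rfl fun A _ => hinner A]
  exact (neg_eq_of_add_eq_zero_right htotal).symm

end BinomialSums

section InverseKL

variable {α : Type u} [Finite α] {M : Matroid α} {i : ℕ}

theorem satisfiesRecursion_inverseKL (M : Matroid α) : SatisfiesRecursion inverseKL M :=
  isInverseKL_inverseKL.recursion M

theorem coeff_inverseKL_of_rank_le (hE : M.E.Nonempty) (hi : rank M ≤ 2 * i) :
    (inverseKL M).coeff i = 0 := by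
  rcases (rank M).eq_zero_or_pos with h | h
  · rw [isInverseKL_inverseKL.rank_zero_of_nonempty M h hE, coeff_zero]
  · have hdeg := isInverseKL_inverseKL.degree_lt M h
    exact coeff_eq_zero_of_natDegree_lt (by omega)

theorem coeff_reflect_inverseKL {d : ℕ} (hE : M.E.Nonempty) (hd : rank M ≤ d) (hi : 2 * i ≤ d) :
    (reflect d (inverseKL M)).coeff i = 0 := by
  rw [coeff_reflect, revAt_le (by omega)]
  exact coeff_inverseKL_of_rank_le hE (by omega)

theorem coeff_inverseKL (hi : 2 * i < rank M) :
    (inverseKL M).coeff i = (-1) ^ (rank M + 1) * (properSum inverseKL M).coeff i := by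
  have hE : M.E.Nonempty := by
    by_contra! hE
    rw [rank, hE, rk_empty] at hi
    omega
  have hrec := congrArg (coeff · i) (satisfiesRecursion_iff.1 (satisfiesRecursion_inverseKL M))
  simp only [coeff_add, coeff_neg_one_pow_mul, coeff_reflect_inverseKL hE le_rfl hi.le,
    mul_zero] at hrec
  have hsign : ((-1) ^ rank M * (-1) ^ rank M : ℤ) = 1 := by rw [← mul_pow]; simp
  linear_combination -(inverseKL M).coeff i * hsign - (-1) ^ rank M * hrec

end InverseKL

section Uniform

open Finset

open scoped Classical

variable {α : Type u} [Finite α] {M : Matroid α} {k : ℕ}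

attribute [local instance] Fintype.ofFinite

attribute [local instance] Fintype.toLocallyFiniteOrder

/-- The matroids whose independent sets are the subsets of the ground set of cardinality at most
their rank `k`. -/
structure IsUniform (M : Matroid α) (k : ℕ) : Prop where
  indep_iff : ∀ I ⊆ M.E, M.Indep I ↔ I.ncard ≤ k
  le_ncard : k ≤ M.E.ncard

theorem isUniform_uniform (k n : ℕ) (hkn : k ≤ n) : IsUniform (uniform k n hkn) k where
  indep_iff I _ := by
    rw [Matroid.indep_iff]
    refine ⟨fun ⟨B, hB, hIB⟩ => ?_, fun h => ?_⟩
    · have hBk : B.ncard = k := hB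
      exact hBk ▸ Set.ncard_le_ncard hIB (Set.toFinite _)
    · obtain ⟨B, hIB, -, hB⟩ := Set.exists_subsuperset_card_eq (Set.subset_univ I) h
        (by rwa [Set.ncard_univ, Nat.card_fin])
      exact ⟨B, hB, hIB⟩
  le_ncard := by rwa [show (uniform k n hkn).E = Set.univ from rfl, Set.ncard_univ, Nat.card_fin]

theorem isUniform_restrict_of_indep {I : Set α} (hI : M.Indep I) :
    IsUniform (M.restrict I) I.ncard where
  indep_iff J hJ := by
    rw [Matroid.restrict_indep_iff]
    exact ⟨fun _ => Set.ncard_le_ncard hJ (Set.toFinite _), fun _ => ⟨hI.subset hJ, hJ⟩⟩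
  le_ncard := le_rfl

theorem rk_eq_min_of_indep_iff {X : Set α} (h : ∀ I ⊆ X, M.Indep I ↔ I.ncard ≤ k) :
    rk M X = min X.ncard k := by
  obtain ⟨I, hI⟩ := M.exists_isBasis' X
  have hrk : rk M X = I.ncard := by rw [rk, hI.eRk_eq_encard, Set.ncard_def]
  refine le_antisymm (le_min (rk_le_ncard M X) (hrk ▸ (h I hI.subset).1 hI.indep)) ?_
  obtain ⟨J, hJX, hJ⟩ := Set.exists_subset_card_eq (min_le_left X.ncard k)
  have hindep := (h J hJX).2 (hJ.trans_le (min_le_right _ _))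
  rw [← hJ, ← (indep_iff_rk M).1 hindep]
  exact rk_mono M hJX

namespace IsUniform

theorem rk_eq (hM : IsUniform M k) {X : Set α} (hX : X ⊆ M.E) : rk M X = min X.ncard k :=
  rk_eq_min_of_indep_iff fun I hI => hM.indep_iff I (hI.trans hX)

theorem rank_eq (hM : IsUniform M k) : rank M = k := by
  rw [rank, hM.rk_eq subset_rfl, min_eq_right hM.le_ncard]

theorem isFlat_and_ne_ground_iff (hM : IsUniform M k) {F : Set α} :
    M.IsFlat F ∧ F ≠ M.E ↔ F ⊆ M.E ∧ F.ncard < k := by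
  constructor
  · rintro ⟨hF, hne⟩
    have hlt := rk_lt_rank_of_isFlat M hF hne
    rw [hM.rk_eq hF.subset_ground, hM.rank_eq] at hlt
    exact ⟨hF.subset_ground, by omega⟩
  · rintro ⟨hF, hlt⟩
    refine ⟨(isFlat_iff_rk M).2 ⟨hF, fun e he => ?_⟩, ?_⟩
    · rw [hM.rk_eq hF, hM.rk_eq (Set.insert_subset he.1 hF),
        Set.ncard_insert_of_notMem he.2 (Set.toFinite _)]
      omega
    · rintro rfl
      exact hlt.not_ge hM.le_ncard

theorem properSum_eq (hM : IsUniform M k) {Q : Matroid α → ℤ[X]}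
    (hQ : ∀ F ⊆ M.E, F.ncard < k → Q (M.restrict F) = 1) :
    properSum Q M = truncBinomial M.E.ncard k - reflect k (truncBinomial M.E.ncard k) := by
  calc properSum Q M
      = ∑ F ∈ Icc ∅ M.E with F.ncard < k, (-1) ^ F.ncard *
          ∑ A ∈ Icc F M.E, (-1) ^ (A \ F).ncard * X ^ (min A.ncard k - F.ncard) := by
        rw [properSum]
        refine sum_congr ?_ fun F hF => ?_
        · ext F
          simp only [hM.isFlat_and_ne_ground_iff, mem_filter, mem_univ, true_and, mem_Icc,
            Set.empty_subset]
        · obtain ⟨hFE, hlt⟩ : F ⊆ M.E ∧ F.ncard < k :=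
            (mem_filter.1 hF).imp_left fun h => (mem_Icc.1 h).2
          rw [hQ F hFE hlt, hM.rk_eq hFE, min_eq_left hlt.le, mul_one, reverseIntervalCharPoly]
          refine congrArg _ (sum_congr rfl fun A hA => ?_)
          rw [hM.rk_eq (mem_Icc.1 hA).2, hM.rk_eq hFE, min_eq_left hlt.le]
    _ = ∑ A ∈ Icc ∅ M.E, (-1) ^ A.ncard *
          ∑ F ∈ Icc ∅ A with F.ncard < k, X ^ (min A.ncard k - F.ncard) :=
        sum_Icc_empty_neg_one_pow_mul M.E (fun F => F.ncard < k)
          fun F A => X ^ (min A.ncard k - F.ncard)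
    _ = truncBinomial M.E.ncard k - reflect k (truncBinomial M.E.ncard k) := by
        rw [sub_eq_add_neg, ← sum_le_ncard_eq_neg_reflect_truncBinomial hM.le_ncard k.le_succ,
          ← sum_ncard_lt_eq_truncBinomial,
          ← sum_filter_add_sum_filter_not _ fun A : Set α => A.ncard < k]
        refine congrArg₂ (· + ·) (sum_congr rfl fun A hA => ?_) (sum_congr rfl fun A hA => ?_)
        · rw [min_eq_left (mem_filter.1 hA).2.le]
        · rw [min_eq_right (not_lt.1 (mem_filter.1 hA).2)]

end IsUniform

theorem inverseKL_of_isUniform_ncard (hM : IsUniform M M.E.ncard) : inverseKL M = 1 := by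
  induction hn : M.E.ncard using Nat.strong_induction_on generalizing M with | _ n ih =>
  rw [hn] at hM
  rcases M.E.eq_empty_or_nonempty with hE | hE
  · rw [isInverseKL_inverseKL.rank_zero_of_empty M _ hE]
    rw [hM.rank_eq, ← hn, hE, Set.ncard_empty]
  have hpos : 0 < n := hn ▸ (Set.ncard_pos (Set.toFinite _)).2 hE
  have hproper := hM.properSum_eq (Q := inverseKL) fun F hF hlt =>
    ih F.ncard hlt (isUniform_restrict_of_indep ((hM.indep_iff F hF).2 hlt.le)) rfl
  rw [hn, truncBinomial_self_sub_reflect] at hproper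
  ext i
  by_cases hi : 2 * i < n
  · rw [coeff_inverseKL (by rwa [hM.rank_eq]), hproper, hM.rank_eq, coeff_neg_one_pow_mul,
      ← mul_assoc, ← pow_add, coeff_sub, coeff_X_pow, if_neg (by omega), zero_sub, mul_neg,
      (by exact ⟨n, by ring⟩ : Odd (n + 1 + n)).neg_one_pow, neg_mul, one_mul, neg_neg]
  · rw [coeff_inverseKL_of_rank_le hE (by rw [hM.rank_eq]; omega), coeff_one, if_neg (by omega)]

theorem inverseKL_restrict_of_indep {I : Set α} (hI : M.Indep I) :
    inverseKL (M.restrict I) = 1 :=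
  inverseKL_of_isUniform_ncard (isUniform_restrict_of_indep hI)

theorem IsUniform.sub_reflect_truncBinomial_eq (hM : IsUniform M k) :
    (-1) ^ k * inverseKL M - reflect k (truncBinomial M.E.ncard (k + 1)) =
      (-1) ^ k * reflect k (inverseKL M) - truncBinomial M.E.ncard (k + 1) := by
  have hrec := satisfiesRecursion_iff.1 (satisfiesRecursion_inverseKL M)
  rw [hM.rank_eq, hM.properSum_eq fun F hF hlt =>
    inverseKL_restrict_of_indep ((hM.indep_iff F hF).2 hlt.le)] at hrec
  rw [truncBinomial_succ, reflect_add, mul_assoc, reflect_neg_one_pow_mul, ← C_eq_natCast,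
    reflect_C_mul, reflect_one_add_X_pow_self, hrec]
  ring

theorem IsUniform.inverseKL_eq (hM : IsUniform M k) (hE : M.E.Nonempty) :
    inverseKL M = ∑ i ∈ range ((k + 1) / 2),
      C (syt (M.E.ncard - k + 1) i (k - 2 * i - 1) : ℤ) * X ^ i := by
  ext i
  rw [coeff_sum_range_C_mul_X_pow fun i => (syt (M.E.ncard - k + 1) i (k - 2 * i - 1) : ℤ)]
  by_cases hi : 2 * i < k
  · rw [if_pos (by omega), syt_eq_coeff_truncBinomial hM.le_ncard hi,
      coeff_inverseKL (by rwa [hM.rank_eq]), hM.rank_eq, hM.properSum_eq fun F hF hlt =>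
        inverseKL_restrict_of_indep ((hM.indep_iff F hF).2 hlt.le),
      coeff_sub, coeff_reflect, revAt_le (by omega)]
  · rw [coeff_inverseKL_of_rank_le hE (by rw [hM.rank_eq]; omega), if_neg (by omega)]

end Uniform

section Corank

open Finset

open scoped Classical

variable {α : Type u} [Finite α] {M : Matroid α} {F : Set α}

attribute [local instance] Fintype.ofFinite

attribute [local instance] Fintype.toLocallyFiniteOrder

theorem reverseIntervalCharPoly_of_rk_add_one_eq_rank (hF : M.IsFlat F)
    (hrk : rk M F + 1 = rank M) : reverseIntervalCharPoly M F M.E = 1 - X := by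
  have hne : F ≠ M.E := by
    rintro rfl
    exact (Nat.succ_ne_self _ hrk).elim
  have hrank : ∀ A ∈ Ioc F M.E, rk M A - rk M F = 1 := fun A hA => by
    obtain ⟨hFA, hAE⟩ := mem_Ioc.1 hA
    obtain ⟨e, heA, heF⟩ := Set.exists_of_ssubset hFA
    have hinsert := ((isFlat_iff_rk M).1 hF).2 e ⟨hAE heA, heF⟩
    have hle := rk_mono M (Set.insert_subset heA hFA.subset)
    have hle_rank := rk_le_rank M A
    omega
  have hsum := congrArg (Int.cast : ℤ → ℤ[X]) (sum_Icc_neg_one_pow_ncard hF.subset_ground)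
  rw [if_neg hne, ← add_sum_Ioc_eq_sum_Icc hF.subset_ground, Set.sdiff_self] at hsum
  push_cast at hsum
  rw [reverseIntervalCharPoly, ← add_sum_Ioc_eq_sum_Icc hF.subset_ground, Set.sdiff_self,
    sum_congr rfl fun A hA => by rw [hrank A hA], ← sum_mul]
  simp only [Set.ncard_empty, pow_zero, pow_one, Nat.sub_self, mul_one] at hsum ⊢
  linear_combination X * hsum

-- Inserting or removing an element of the closure pairs the terms with opposite signs.
theorem reverseIntervalCharPoly_of_not_isFlat (hFE : F ⊆ M.E) (hF : ¬ M.IsFlat F) :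
    reverseIntervalCharPoly M F M.E = 0 := by
  obtain ⟨e, he, heF⟩ : ∃ e ∈ M.closure F, e ∉ F := by
    by_contra! hsub
    exact hF (M.isFlat_iff_closure_eq.2 (Set.Subset.antisymm hsub (M.subset_closure F hFE)))
  have hpair : ∀ A, F ⊆ A → e ∉ A →
      (-1 : ℤ[X]) ^ (insert e A \ F).ncard * X ^ (rk M (insert e A) - rk M F) =
        -((-1) ^ (A \ F).ncard * X ^ (rk M A - rk M F)) := fun A hFA heA => by
    rw [Set.insert_sdiff_of_notMem _ heF,
      Set.ncard_insert_of_notMem (fun h => heA h.1) (Set.toFinite _), ← rk_closure,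
      M.closure_insert_eq_of_mem_closure (M.closure_subset_closure hFA he), rk_closure]
    ring
  refine sum_involution (fun A _ => if e ∈ A then A \ {e} else insert e A) (fun A hA => ?_)
    (fun A _ _ => ?_) (fun A hA => ?_) fun A _ => ?_
  · split_ifs with heA
    · have hremove := hpair (A \ {e}) (Set.subset_sdiff_singleton (mem_Icc.1 hA).1 heF) (by simp)
      rw [Set.insert_sdiff_self_of_mem heA] at hremove
      rw [hremove, neg_add_cancel]
    · rw [hpair A (mem_Icc.1 hA).1 heA, add_neg_cancel]
  · split_ifs with heA
    · exact fun h => (h.ge heA).2 rfl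
    · exact fun h => heA (h ▸ Set.mem_insert e A)
  · obtain ⟨hFA, hAE⟩ := mem_Icc.1 hA
    split_ifs
    · exact mem_Icc.2 ⟨Set.subset_sdiff_singleton hFA heF, Set.sdiff_subset.trans hAE⟩
    · exact mem_Icc.2 ⟨hFA.trans (Set.subset_insert e A),
        Set.insert_subset (M.closure_subset_ground F he) hAE⟩
  · by_cases heA : e ∈ A
    · rw [if_pos heA, if_neg fun h => h.2 rfl, Set.insert_sdiff_self_of_mem heA]
    · rw [if_neg heA, if_pos (Set.mem_insert e A), Set.insert_sdiff_self_of_notMem heA]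

end Corank

section Relaxation

open Finset

open scoped Classical

variable {α : Type u} [Finite α] {M : Matroid α} {H : Set α} (hH : IsStressedHyperplane M H)

attribute [local instance] Fintype.ofFinite

attribute [local instance] Fintype.toLocallyFiniteOrder

namespace IsStressedHyperplane

include hH

theorem ground_not_subset : ¬ M.E ⊆ H := fun h => by
  have hle : rank M ≤ rk M H := rk_mono M h
  have hrk := hH.rk_add_one
  omega

theorem indep_iff {I : Set α} (hI : I ⊆ H) : M.Indep I ↔ I.ncard ≤ rk M H := by
  have hrk := hH.rk_add_one
  refine ⟨fun h => (indep_iff_rk M).1 h ▸ rk_mono M hI, fun h => ?_⟩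
  rcases le_or_gt (rank M) H.ncard with hle | hlt
  · obtain ⟨S, hIS, hSH, hS⟩ := Set.exists_subsuperset_card_eq hI (by omega) hle
    refine (hH.isCircuit S hSH hS).ssubset_indep (hIS.ssubset_of_ne ?_)
    rintro rfl
    omega
  · have hle := rk_le_ncard M H
    exact ((indep_iff_rk M).2 (by omega : rk M H = H.ncard)).subset hI

theorem isUniform_restrict : IsUniform (M.restrict H) (rk M H) where
  indep_iff I hI := by
    rw [Matroid.restrict_indep_iff, hH.indep_iff hI]
    exact and_iff_left hI
  le_ncard := rk_le_ncard M H

theorem rk_eq {X : Set α} (hX : X ⊆ H) : rk M X = min X.ncard (rk M H) :=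
  rk_eq_min_of_indep_iff fun _ hI => hH.indep_iff (hI.trans hX)

theorem rk_insert {X : Set α} (hX : X ⊆ H) {e : α} (he : e ∈ M.E \ H) :
    rk M (insert e X) = rk M X + 1 := by
  have hcl := (closure_subset_iff M hH.isFlat (hX.trans hH.isFlat.subset_ground)).2 hX
  have hsucc := ((isFlat_iff_rk M).1 (M.isFlat_closure X)).2 e ⟨he.1, fun h => he.2 (hcl h)⟩
  rw [← rk_closure M (insert e X), ← M.closure_insert_closure_eq_closure_insert, rk_closure,
    hsucc, rk_closure]

theorem indep_relax_iff (I : Set α) :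
    (relax M H hH).Indep I ↔ M.Indep I ∨ (I ⊆ H ∧ I.ncard ≤ rank M) := by
  rw [Matroid.indep_iff]
  constructor
  · rintro ⟨B, hB | ⟨hBH, hB⟩, hIB⟩
    · exact Or.inl (hB.indep.subset hIB)
    · exact Or.inr ⟨hIB.trans hBH, hB ▸ Set.ncard_le_ncard hIB (Set.toFinite _)⟩
  · intro h
    by_cases hI : M.Indep I
    · obtain ⟨B, hB, hIB⟩ := hI.exists_isBase_superset
      exact ⟨B, Or.inl hB, hIB⟩
    · obtain ⟨hIH, hle⟩ := h.resolve_left hI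
      rw [hH.indep_iff hIH] at hI
      have hrk := hH.rk_add_one
      have hcard := Set.ncard_le_ncard hIH (Set.toFinite _)
      obtain ⟨S, hIS, hSH, hS⟩ := Set.exists_subsuperset_card_eq hIH hle (by omega)
      exact ⟨S, Or.inr ⟨hSH, hS⟩, hIS⟩

theorem indep_relax_iff_of_subset {I : Set α} (hI : I ⊆ H) :
    (relax M H hH).Indep I ↔ I.ncard ≤ rank M := by
  rw [hH.indep_relax_iff, hH.indep_iff hI, ← hH.rk_add_one]
  simp only [hI, true_and]
  omega

theorem rk_relax_of_subset {X : Set α} (hX : X ⊆ H) :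
    rk (relax M H hH) X = min X.ncard (rank M) :=
  rk_eq_min_of_indep_iff fun _ hI => hH.indep_relax_iff_of_subset (hI.trans hX)

theorem rk_relax_of_not_subset {X : Set α} (hXE : X ⊆ M.E) (hX : ¬ X ⊆ H) :
    rk (relax M H hH) X = rk M X := by
  refine le_antisymm ?_ ?_
  · obtain ⟨I, hI⟩ := (relax M H hH).exists_isBasis' X
    rw [show rk (relax M H hH) X = I.ncard by rw [rk, hI.eRk_eq_encard, Set.ncard_def]]
    rcases (hH.indep_relax_iff I).1 hI.indep with h | ⟨hIH, hle⟩
    · rw [← (indep_iff_rk M).1 h]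
      exact rk_mono M hI.subset
    · obtain ⟨e, heX, heH⟩ := Set.not_subset.1 hX
      have hrk := hH.rk_add_one
      have hsucc := hH.rk_insert hIH ⟨hXE heX, heH⟩
      have hmono := rk_mono M (Set.insert_subset heX hI.subset)
      rw [hH.rk_eq hIH] at hsucc
      omega
  · obtain ⟨I, hI⟩ := M.exists_isBasis' X
    rw [show rk M X = I.ncard by rw [rk, hI.eRk_eq_encard, Set.ncard_def],
      ← (indep_iff_rk _).1 ((hH.indep_relax_iff I).2 (Or.inl hI.indep))]
    exact rk_mono _ hI.subset

theorem rank_relax : rank (relax M H hH) = rank M :=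
  hH.rk_relax_of_not_subset subset_rfl hH.ground_not_subset

theorem relax_eq_self (h : H.ncard < rank M) : relax M H hH = M := by
  refine Matroid.ext_indep rfl fun I _ => ?_
  rw [hH.indep_relax_iff, or_iff_left_iff_imp]
  rintro ⟨hIH, -⟩
  have hrk := hH.rk_add_one
  have hle := Set.ncard_le_ncard hIH (Set.toFinite _)
  exact (hH.indep_iff hIH).2 (by omega)

theorem isFlat_and_subset_and_ne_iff {F : Set α} :
    (M.IsFlat F ∧ F ⊆ H) ∧ F ≠ H ↔ F ⊆ H ∧ F.ncard < rk M H := by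
  rw [← isFlat_restrict_iff M hH.isFlat]
  exact hH.isUniform_restrict.isFlat_and_ne_ground_iff

theorem isFlat_relax_iff_of_subset {F : Set α} (hF : F ⊆ H) :
    (relax M H hH).IsFlat F ↔ F.ncard < rank M := by
  have hFE := hF.trans hH.isFlat.subset_ground
  constructor
  · intro hflat
    have hlt := rk_lt_rank_of_isFlat _ hflat fun h => hH.ground_not_subset (h.ge.trans hF)
    rw [hH.rank_relax, hH.rk_relax_of_subset hF] at hlt
    omega
  · refine fun h => (isFlat_iff_rk _).2 ⟨hFE, fun e he => ?_⟩
    have hrk := hH.rk_add_one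
    rw [hH.rk_relax_of_subset hF]
    by_cases heH : e ∈ H
    · rw [hH.rk_relax_of_subset (Set.insert_subset heH hF),
        Set.ncard_insert_of_notMem he.2 (Set.toFinite _)]
      omega
    · rw [hH.rk_relax_of_not_subset (Set.insert_subset he.1 hFE)
        fun h => heH (h (Set.mem_insert e F)), hH.rk_insert hF ⟨he.1, heH⟩, hH.rk_eq hF]
      omega

theorem isFlat_relax_iff_of_not_subset {F : Set α} (hF : ¬ F ⊆ H) :
    (relax M H hH).IsFlat F ↔ M.IsFlat F := by
  rw [isFlat_iff_rk, isFlat_iff_rk]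
  refine and_congr_right fun hFE => forall₂_congr fun e he => ?_
  rw [hH.rk_relax_of_not_subset hFE hF, hH.rk_relax_of_not_subset (Set.insert_subset he.1 hFE)
    fun h => hF ((Set.subset_insert e F).trans h)]

theorem restrict_relax {F : Set α} (hF : ¬ F ⊆ H) (hflat : M.IsFlat F) (hne : F ≠ M.E) :
    (relax M H hH).restrict F = M.restrict F := by
  refine eq_of_rk_eq rfl fun X (hX : X ⊆ F) => ?_
  have hFE := hflat.subset_ground
  rw [rk_restrict _ hX, rk_restrict _ hX]
  by_cases hXH : X ⊆ H
  · obtain ⟨e, heF, heH⟩ := Set.not_subset.1 hF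
    have hrk := hH.rk_add_one
    have hsucc := hH.rk_insert hXH ⟨hFE heF, heH⟩
    have hmono := rk_mono M (Set.insert_subset heF hX)
    have hlt := rk_lt_rank_of_isFlat M hflat hne
    rw [hH.rk_eq hXH] at hsucc
    rw [hH.rk_eq hXH, hH.rk_relax_of_subset hXH]
    omega
  · exact hH.rk_relax_of_not_subset (hX.trans hFE) hXH

theorem reverseIntervalCharPoly_relax_of_not_subset {F : Set α} (hFE : F ⊆ M.E) (hF : ¬ F ⊆ H) :
    reverseIntervalCharPoly (relax M H hH) F M.E = reverseIntervalCharPoly M F M.E := by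
  refine sum_congr rfl fun A hA => ?_
  obtain ⟨hFA, hAE⟩ := mem_Icc.1 hA
  rw [hH.rk_relax_of_not_subset hFE hF,
    hH.rk_relax_of_not_subset hAE fun h => hF (hFA.trans h)]

theorem reverseIntervalCharPoly_relax_sub {F : Set α} (hF : F ⊆ H) (hlt : F.ncard < rank M) :
    reverseIntervalCharPoly (relax M H hH) F M.E - reverseIntervalCharPoly M F M.E =
      ∑ A ∈ Icc F H, (-1) ^ (A \ F).ncard *
        (X ^ (min A.ncard (rank M) - F.ncard) - X ^ (min A.ncard (rk M H) - F.ncard)) := by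
  have hrk := hH.rk_add_one
  have hrkF : rk M F = F.ncard := by rw [hH.rk_eq hF]; omega
  have hrkF_relax : rk (relax M H hH) F = F.ncard := by rw [hH.rk_relax_of_subset hF]; omega
  rw [reverseIntervalCharPoly, reverseIntervalCharPoly, ← sum_sub_distrib, hrkF, hrkF_relax]
  symm
  refine sum_subset_zero_on_sdiff (Icc_subset_Icc_right hH.isFlat.subset_ground)
    (fun A hA => ?_) fun A hA => ?_
  · rw [mem_sdiff, mem_Icc, mem_Icc] at hA
    rw [hH.rk_relax_of_not_subset hA.1.2 fun h => hA.2 ⟨hA.1.1, h⟩, sub_self]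
  · have hAH := (mem_Icc.1 hA).2
    rw [hH.rk_eq hAH, hH.rk_relax_of_subset hAH, mul_sub]

end IsStressedHyperplane

end Relaxation

section RelaxationDifference

open Finset

open scoped Classical

variable {α : Type u} [Finite α] {M : Matroid α} {H : Set α} (hH : IsStressedHyperplane M H)

attribute [local instance] Fintype.ofFinite

attribute [local instance] Fintype.toLocallyFiniteOrder

namespace IsStressedHyperplane

include hH

theorem sum_flats_subset (hle : rank M ≤ H.ncard) :
    ∑ F with (M.IsFlat F ∧ F ≠ M.E) ∧ F ⊆ H,
        (-1) ^ rk M F * inverseKL (M.restrict F) * reverseIntervalCharPoly M F M.E =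
      (-1) ^ rk M H * inverseKL (M.restrict H) * (1 - X) +
        ∑ F ∈ Icc ∅ H with F.ncard < rank M,
          (-1) ^ F.ncard * reverseIntervalCharPoly M F M.E := by
  have hrk := hH.rk_add_one
  have hmem : H ∈ ({F | (M.IsFlat F ∧ F ≠ M.E) ∧ F ⊆ H} : Finset (Set α)) :=
    (mem_filter_univ _).2 ⟨⟨hH.isFlat, fun h => hH.ground_not_subset h.ge⟩, subset_rfl⟩
  rw [← add_sum_erase _ _ hmem,
    reverseIntervalCharPoly_of_rk_add_one_eq_rank hH.isFlat hH.rk_add_one]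
  refine congrArg _ (sum_subset_zero_on_sdiff (fun F hF => ?_) (fun F hF => ?_) fun F hF => ?_)
  · rw [mem_erase, mem_filter_univ] at hF
    have hlt := hH.isFlat_and_subset_and_ne_iff.1 ⟨⟨hF.2.1.1, hF.2.2⟩, hF.1⟩
    exact mem_filter.2 ⟨mem_Icc.2 ⟨Set.empty_subset F, hlt.1⟩, by omega⟩
  · rw [mem_sdiff, mem_filter, mem_Icc, mem_erase, mem_filter_univ] at hF
    obtain ⟨⟨⟨-, hFH⟩, hlt⟩, hnot⟩ := hF
    rw [reverseIntervalCharPoly_of_not_isFlat (hFH.trans hH.isFlat.subset_ground), mul_zero]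
    refine fun hflat => hnot ⟨?_, ⟨hflat, fun h => hH.ground_not_subset (h.ge.trans hFH)⟩, hFH⟩
    rintro rfl
    omega
  · rw [mem_erase, mem_filter_univ] at hF
    have hlt := hH.isFlat_and_subset_and_ne_iff.1 ⟨⟨hF.2.1.1, hF.2.2⟩, hF.1⟩
    have hindep := (hH.indep_iff hlt.1).2 hlt.2.le
    rw [inverseKL_restrict_of_indep hindep, (indep_iff_rk M).1 hindep, mul_one]

theorem sum_flats_relax_subset :
    ∑ F with ((relax M H hH).IsFlat F ∧ F ≠ M.E) ∧ F ⊆ H,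
        (-1) ^ rk (relax M H hH) F * inverseKL ((relax M H hH).restrict F) *
          reverseIntervalCharPoly (relax M H hH) F M.E =
      ∑ F ∈ Icc ∅ H with F.ncard < rank M,
        (-1) ^ F.ncard * reverseIntervalCharPoly (relax M H hH) F M.E := by
  refine sum_congr ?_ fun F hF => ?_
  · ext F
    rw [mem_filter_univ, mem_filter, mem_Icc]
    constructor
    · rintro ⟨⟨hflat, -⟩, hFH⟩
      exact ⟨⟨Set.empty_subset F, hFH⟩, (hH.isFlat_relax_iff_of_subset hFH).1 hflat⟩
    · rintro ⟨⟨-, hFH⟩, hlt⟩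
      exact ⟨⟨(hH.isFlat_relax_iff_of_subset hFH).2 hlt,
        fun h => hH.ground_not_subset (h.ge.trans hFH)⟩, hFH⟩
  · obtain ⟨hmem, hlt⟩ := mem_filter.1 hF
    have hindep := (hH.indep_relax_iff_of_subset (mem_Icc.1 hmem).2).2 hlt.le
    rw [inverseKL_restrict_of_indep hindep, (indep_iff_rk _).1 hindep, mul_one]

theorem sum_flats_relax_not_subset :
    ∑ F with ((relax M H hH).IsFlat F ∧ F ≠ M.E) ∧ ¬ F ⊆ H,
        (-1) ^ rk (relax M H hH) F * inverseKL ((relax M H hH).restrict F) *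
          reverseIntervalCharPoly (relax M H hH) F M.E =
      ∑ F with (M.IsFlat F ∧ F ≠ M.E) ∧ ¬ F ⊆ H,
        (-1) ^ rk M F * inverseKL (M.restrict F) * reverseIntervalCharPoly M F M.E := by
  refine sum_congr ?_ fun F hF => ?_
  · refine filter_congr fun F _ => and_congr_left fun hFH => and_congr_left fun _ => ?_
    exact hH.isFlat_relax_iff_of_not_subset hFH
  · obtain ⟨⟨hflat, hne⟩, hFH⟩ := (mem_filter_univ _).1 hF
    have hFE := hflat.subset_ground
    rw [hH.rk_relax_of_not_subset hFE hFH, hH.restrict_relax hFH hflat hne,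
      hH.reverseIntervalCharPoly_relax_of_not_subset hFE hFH]

theorem sum_reverseIntervalCharPoly_relax_sub (hle : rank M ≤ H.ncard) :
    ∑ F ∈ Icc ∅ H with F.ncard < rank M, (-1) ^ F.ncard *
        (reverseIntervalCharPoly (relax M H hH) F M.E - reverseIntervalCharPoly M F M.E) =
      (1 - X) * reflect (rk M H) (truncBinomial H.ncard (rank M)) := by
  have hrk := hH.rk_add_one
  rw [sum_congr rfl fun F hF => by
    rw [hH.reverseIntervalCharPoly_relax_sub (mem_Icc.1 (mem_filter.1 hF).1).2 (mem_filter.1 hF).2],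
    sum_Icc_empty_neg_one_pow_mul H (fun F => F.ncard < rank M) fun F A =>
      (X ^ (min A.ncard (rank M) - F.ncard) - X ^ (min A.ncard (rk M H) - F.ncard) : ℤ[X]),
    ← neg_sub X, neg_mul_comm, ← sum_le_ncard_eq_neg_reflect_truncBinomial hle hrk.ge, mul_sum]
  symm
  refine sum_subset_zero_on_sdiff (filter_subset _ _) (fun A hA => ?_) fun A hA => ?_
  · rw [mem_sdiff, mem_filter, not_and_not_right] at hA
    have hlt := hA.2 hA.1
    rw [min_eq_left hlt.le, min_eq_left (by omega)]
    simp only [sub_self, sum_const_zero, mul_zero]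
  · have hA_le := not_lt.1 (mem_filter.1 hA).2
    rw [mul_left_comm, mul_sum, min_eq_right hA_le, min_eq_right (by omega)]
    refine congrArg _ (sum_congr rfl fun F hF => ?_)
    have hF_lt := (mem_filter.1 hF).2
    rw [show rank M - F.ncard = rk M H - F.ncard + 1 by omega, pow_succ]
    ring

theorem properSum_relax (hle : rank M ≤ H.ncard) :
    properSum inverseKL (relax M H hH) = properSum inverseKL M +
      (1 - X) * (truncBinomial H.ncard (rank M) -
        (-1) ^ rk M H * reflect (rk M H) (inverseKL (M.restrict H))) := by
  have hM : properSum inverseKL M = _ :=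
    (sum_filter_add_sum_filter_not _ (· ⊆ H) _).symm
  have hrelax : properSum inverseKL (relax M H hH) = _ :=
    (sum_filter_add_sum_filter_not _ (· ⊆ H) _).symm
  rw [filter_filter, filter_filter, hH.sum_flats_subset hle] at hM
  rw [filter_filter, filter_filter, show (relax M H hH).E = M.E from rfl,
    hH.sum_flats_relax_subset, hH.sum_flats_relax_not_subset] at hrelax
  have hdiff := hH.sum_reverseIntervalCharPoly_relax_sub hle
  simp only [mul_sub, sum_sub_distrib] at hdiff
  have hunif := hH.isUniform_restrict.sub_reflect_truncBinomial_eq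
  rw [Matroid.restrict_ground_eq, hH.rk_add_one] at hunif
  linear_combination hrelax - hM + hdiff - (1 - X) * hunif

end IsStressedHyperplane

end RelaxationDifference

section RelaxationPolynomial

open Finset

/-- The polynomial `q_{k,h}`, by which the relaxation of a stressed hyperplane of cardinality `h`
in a matroid of rank `k` changes the inverse Kazhdan–Lusztig polynomial. -/
def relaxationPolynomial (k h : ℕ) : ℤ[X] :=
  ∑ i ∈ range ((k + 1) / 2), C (sytBar (h + 2 - k) i (k - 2 * i - 1) : ℤ) * X ^ i

theorem coeff_relaxationPolynomial (k h i : ℕ) : (relaxationPolynomial k h).coeff i =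
    if i < (k + 1) / 2 then (sytBar (h + 2 - k) i (k - 2 * i - 1) : ℤ) else 0 :=
  coeff_sum_range_C_mul_X_pow (fun i => (sytBar (h + 2 - k) i (k - 2 * i - 1) : ℤ)) _ i

theorem coeff_relaxationPolynomial_nonneg (k h i : ℕ) : 0 ≤ (relaxationPolynomial k h).coeff i := by
  rw [coeff_relaxationPolynomial]
  split_ifs <;> positivity

theorem degree_relaxationPolynomial {k h : ℕ} (hk : 1 ≤ k) (hkh : k ≤ h) :
    (relaxationPolynomial k h).degree = (((k - 1) / 2 : ℕ) : WithBot ℕ) := by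
  refine degree_eq_of_le_of_coeff_ne_zero ((degree_le_iff_coeff_zero _ _).2 fun m hm => ?_) ?_
  · rw [coeff_relaxationPolynomial, if_neg]
    have := Nat.cast_lt.1 hm
    omega
  · rw [coeff_relaxationPolynomial, if_pos (by omega), show h + 2 - k = h - k + 2 by omega]
    exact_mod_cast (sytBar_pos _ _ _).ne'

theorem relaxationPolynomial_succ_self {h : ℕ} (hh : 1 ≤ h) :
    relaxationPolynomial (h + 1) h = 0 := by
  ext i
  rw [coeff_relaxationPolynomial, show h + 2 - (h + 1) = 1 by omega, coeff_zero]
  split_ifs with hi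
  · rw [sytBar_one (by omega), Nat.cast_zero]
  · rfl

theorem coeff_relaxationPolynomial_eq_coeff_truncBinomial {k h i : ℕ} (hkh : k ≤ h)
    (hik : 2 * i < k) : (relaxationPolynomial k h).coeff i =
      (-1) ^ (k + 1) * ((1 - X) * truncBinomial h k).coeff i := by
  rw [coeff_relaxationPolynomial, if_pos (by omega), sytBar_eq_coeff_truncBinomial hkh hik]

variable {α : Type u} [Finite α] {M : Matroid α} {H : Set α}

namespace IsStressedHyperplane

variable (hH : IsStressedHyperplane M H)

include hH

theorem coeff_one_sub_X_mul_reflect_inverseKL_restrict (hne : H.Nonempty) {i : ℕ}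
    (hi : 2 * i < rank M) :
    ((1 - X) * ((-1) ^ rk M H * reflect (rk M H) (inverseKL (M.restrict H)))).coeff i = 0 := by
  have hrk := hH.rk_add_one
  have hcoeff : ∀ j ≤ i, (reflect (rk M H) (inverseKL (M.restrict H))).coeff j = 0 := fun j hj =>
    coeff_reflect_inverseKL hne (rank_restrict M H).le (by omega)
  rw [mul_left_comm, coeff_neg_one_pow_mul, sub_mul, one_mul, coeff_sub, hcoeff i le_rfl]
  cases i with
  | zero => rw [coeff_X_mul_zero, sub_zero, mul_zero]
  | succ i => rw [coeff_X_mul, hcoeff i i.le_succ, sub_zero, mul_zero]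

theorem inverseKL_relax (hne : H.Nonempty) :
    inverseKL (relax M H hH) = inverseKL M + relaxationPolynomial (rank M) H.ncard := by
  have hrk := hH.rk_add_one
  rcases le_or_gt (rank M) H.ncard with hle | hlt
  · ext i
    rw [coeff_add]
    rcases lt_or_ge (2 * i) (rank M) with hi | hi
    · rw [coeff_inverseKL (hH.rank_relax.symm ▸ hi), coeff_inverseKL hi, hH.rank_relax,
        hH.properSum_relax hle, coeff_add, mul_sub, coeff_sub,
        hH.coeff_one_sub_X_mul_reflect_inverseKL_restrict hne hi, sub_zero, mul_add,
        coeff_relaxationPolynomial_eq_coeff_truncBinomial hle hi]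
    · have hE : M.E.Nonempty := hne.mono hH.isFlat.subset_ground
      rw [coeff_inverseKL_of_rank_le (M := relax M H hH) hE (hH.rank_relax.trans_le hi),
        coeff_inverseKL_of_rank_le hE hi, coeff_relaxationPolynomial, if_neg (by omega), add_zero]
  · have hcard := rk_le_ncard M H
    rw [hH.relax_eq_self hlt, show rank M = H.ncard + 1 by omega,
      relaxationPolynomial_succ_self ((Set.ncard_pos).2 hne), add_zero]

end IsStressedHyperplane

theorem isRelaxationPolynomial_relaxationPolynomial {k h : ℕ} (hh : 1 ≤ h) :
    IsRelaxationPolynomial.{u} k h (relaxationPolynomial k h) := by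
  rintro α _ M H hH rfl rfl
  exact hH.inverseKL_relax ((Set.ncard_pos).1 hh)

end RelaxationPolynomial

section PointedUniform

variable {α : Type u} [Finite α]

/-- The direct sum of a coloop `x` and the uniform matroid of rank `k - 1` on the other elements,
given by its bases. Deleting `x` leaves a stressed hyperplane. -/
def pointedUniform (x : α) (k : ℕ) (hk : 1 ≤ k) (hkn : k ≤ Nat.card α) : Matroid α :=
  Matroid.ofIsBaseOfFinite (E := Set.univ) (Set.toFinite _) (fun B => x ∈ B ∧ B.ncard = k)
    (by
      obtain ⟨B, hxB, -, hB⟩ := Set.exists_subsuperset_card_eq (n := k) (Set.subset_univ {x})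
        (by rwa [Set.ncard_singleton]) (by rwa [Set.ncard_univ])
      exact ⟨B, hxB rfl, hB⟩)
    (fun A B hA hB a ha => by
      obtain ⟨b, hb⟩ := exists_mem_diff_of_ncard_eq (hA.2.trans hB.2.symm) ha
      refine ⟨b, hb, Or.inr ⟨hA.1, ?_⟩, (ncard_exchange ha.1 hb.2).trans hA.2⟩
      rintro rfl
      exact ha.2 hB.1)
    (fun _ _ => Set.subset_univ _)

variable {x : α} {k : ℕ} {hk : 1 ≤ k} {hkn : k ≤ Nat.card α}

theorem pointedUniform_indep_iff {I : Set α} (hI : I ⊆ {x}ᶜ) :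
    (pointedUniform x k hk hkn).Indep I ↔ I.ncard ≤ k - 1 := by
  have hcard := Set.ncard_insert_of_notMem (fun hx => hI hx rfl : x ∉ I) I.toFinite
  rw [Matroid.indep_iff, Nat.le_sub_iff_add_le hk, ← hcard]
  constructor
  · rintro ⟨B, ⟨hxB, hB⟩, hIB⟩
    exact hB ▸ Set.ncard_le_ncard (Set.insert_subset hxB hIB) B.toFinite
  · intro hle
    obtain ⟨B, hIB, -, hB⟩ := Set.exists_subsuperset_card_eq (Set.subset_univ (insert x I)) hle
      (by rwa [Set.ncard_univ])
    exact ⟨B, ⟨hIB (Set.mem_insert _ _), hB⟩, (Set.subset_insert _ _).trans hIB⟩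

theorem rank_pointedUniform : rank (pointedUniform x k hk hkn) = k := by
  obtain ⟨B, hB⟩ := (pointedUniform x k hk hkn).exists_isBase
  exact (ncard_of_isBase hB).symm.trans hB.2

theorem ncard_compl_singleton (x : α) : ({x}ᶜ : Set α).ncard = Nat.card α - 1 := by
  rw [Set.ncard_compl, Set.ncard_singleton]

theorem rk_pointedUniform_compl_singleton : rk (pointedUniform x k hk hkn) {x}ᶜ = k - 1 := by
  rw [rk_eq_min_of_indep_iff fun _ => pointedUniform_indep_iff, ncard_compl_singleton,
    min_eq_right (Nat.sub_le_sub_right hkn 1)]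

theorem isStressedHyperplane_pointedUniform :
    IsStressedHyperplane (pointedUniform x k hk hkn) {x}ᶜ where
  isFlat := by
    refine (isFlat_iff_rk _).2 ⟨Set.subset_univ _, fun e he => ?_⟩
    have hground : insert e {x}ᶜ = (pointedUniform x k hk hkn).E := by
      rw [Set.notMem_compl_iff.1 he.2, Set.insert_eq, Set.union_compl_self]
      rfl
    rw [hground, ← rank, rank_pointedUniform, rk_pointedUniform_compl_singleton,
      Nat.sub_add_cancel hk]
  rk_add_one := by
    rw [rk_pointedUniform_compl_singleton, rank_pointedUniform, Nat.sub_add_cancel hk]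
  isCircuit S hS hcard := by
    rw [rank_pointedUniform] at hcard
    rw [Matroid.isCircuit_iff_dep_forall_sdiff_singleton_indep, Matroid.dep_iff,
      pointedUniform_indep_iff hS]
    refine ⟨⟨by omega, Set.subset_univ _⟩, fun e he => ?_⟩
    rw [pointedUniform_indep_iff (Set.sdiff_subset.trans hS), Set.ncard_sdiff_singleton_of_mem he,
      hcard]

end PointedUniform

theorem exists_isStressedHyperplane {k h : ℕ} (hk : 1 ≤ k) (hkh : k ≤ h + 1) :
    ∃ (α : Type u) (_ : Finite α) (M : Matroid α) (H : Set α),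
      IsStressedHyperplane M H ∧ rank M = k ∧ H.ncard = h := by
  have hcard : Nat.card (ULift.{u} (Fin (h + 1))) = h + 1 := by
    rw [Nat.card_ulift, Nat.card_fin]
  refine ⟨ULift.{u} (Fin (h + 1)), inferInstance,
    pointedUniform ⟨0⟩ k hk (hkh.trans_eq hcard.symm), {⟨0⟩}ᶜ,
    isStressedHyperplane_pointedUniform, rank_pointedUniform, ?_⟩
  rw [ncard_compl_singleton, hcard, Nat.add_sub_cancel]

theorem isRelaxationPolynomial_iff {k h : ℕ} (hk : 1 ≤ k) (hh : 1 ≤ h) (hkh : k ≤ h + 1)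
    {p : ℤ[X]} : IsRelaxationPolynomial.{u} k h p ↔ p = relaxationPolynomial k h := by
  have hq := isRelaxationPolynomial_relaxationPolynomial.{u} (k := k) hh
  refine ⟨fun hp => ?_, fun h => h ▸ hq⟩
  obtain ⟨α, _, M, H, hH, hM, hHh⟩ := exists_isStressedHyperplane.{u} hk hkh
  exact add_left_cancel ((hp α M H hH hM hHh).symm.trans (hq α M H hH hM hHh))

end MatroidKL

end

/-- Inverse Kazhdan–Lusztig polynomials of uniform matroids, and of the relaxation of a stressed
hyperplane, through standard Young tableaux. The index `i` runs over `0 ≤ i ≤ ⌊(k-1)/2⌋`, that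
is, over all `i < (k+1)/2`; in this range `2 * i + 1 ≤ k`. -/
theorem mainTheorem12 :
    (∀ (k n : ℕ) (hkn : k ≤ n), 1 ≤ n →
      MatroidKL.inverseKL (MatroidKL.uniform k n hkn) =
        ∑ i ∈ Finset.range ((k + 1) / 2),
          C (MatroidKL.syt (n - k + 1) i (k - 2 * i - 1) : ℤ) * X ^ i) ∧
    (∀ k h : ℕ, 1 ≤ k → 1 ≤ h → k ≤ h + 1 →
      ∃ q : ℤ[X],
        (∀ p : ℤ[X], MatroidKL.IsRelaxationPolynomial.{u} k h p ↔ p = q) ∧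
        q = ∑ i ∈ Finset.range ((k + 1) / 2),
          C (MatroidKL.sytBar (h + 2 - k) i (k - 2 * i - 1) : ℤ) * X ^ i ∧
        (∀ m : ℕ, 0 ≤ q.coeff m) ∧
        (k ≤ h → q.degree = (((k - 1) / 2 : ℕ) : WithBot ℕ))) := by
  refine ⟨fun k n hkn hn => ?_, fun k h hk hh hkh => ⟨MatroidKL.relaxationPolynomial k h,
    fun p => MatroidKL.isRelaxationPolynomial_iff hk hh hkh, rfl,
    MatroidKL.coeff_relaxationPolynomial_nonneg k h,
    MatroidKL.degree_relaxationPolynomial hk⟩⟩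
  have hE : (MatroidKL.uniform k n hkn).E.Nonempty := ⟨⟨0, hn⟩, Set.mem_univ _⟩
  have hcard : (MatroidKL.uniform k n hkn).E.ncard = n := by
    rw [show (MatroidKL.uniform k n hkn).E = Set.univ from rfl, Set.ncard_univ, Nat.card_fin]
  simpa only [hcard] using (MatroidKL.isUniform_uniform k n hkn).inverseKL_eq hE
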